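/- **Theorem (IND-CPA security of the signed extension of Paillier).** Let $\mathrm{Gen}$ be a key generation that, for each security parameter $\kappa$, draws distinct odd primes $p,q$ with $p\nmid q-1$ and $q\nmid p-1$, where the length of $n=pq$ is bounded by a polynomial in $\kappa$. The public key is $n$ and the secret key is $\varphi(n)$. Let $$\mathrm{Enc}^{\mathrm{Pail}}(m)=(n+1)^m r^n \bmod n^2\quad (r \text{ uniform in } \mathbb Z_n^*),\qquad \mathrm{Dec}^{\mathrm{Pail}}(c)=\frac{(c^{\varphi(n)}\bmod n^2)-1}{n}\cdot(\varphi(n)^{-1}\bmod n)\bmod n,$$ and, for plaintexts $m\in[-\lfloor n/2\rfloor,\lfloor n/2\rfloor)$ and ciphertexts $c,c_0,c_1\in\mathbb Z_{n^2}^*$, $$\mathrm{Enc}^{\mathrm{Hope}}(m)=\mathrm{Enc}^{\mathrm{Pail}}(m \bmod n),\qquad \mathrm{Dec}^{\mathrm{Hope}}(c)=\big((\mathrm{Dec}^{\mathrm{Pail}}(c)+\lfloor n/2\rfloor)\bmod n\big)-\lfloor n/2\rfloor,$$ $$\mathrm{EvalAdd}^{\mathrm{Hope}}(c_0,c_1)=c_0c_1\bmod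 n^2,\qquad \mathrm{EvalSub}^{\mathrm{Hope}}(c_0,c_1)=c_0c_1^{-1}\bmod n^2 .$$ Assume that the decisional $n$-th residue problem is intractable for these moduli: for every probabilistic polynomial time algorithm $D$, the difference $$\big|\Pr[D(1^\kappa,n,g^n \bmod n^2)=1]-\Pr[D(1^\kappa,n,g)=1]\big|,$$ where $n$ is drawn by $\mathrm{Gen}$ and $g$ is uniform in $\mathbb Z_{n^2}^*$, is negligible in $\kappa$. Then the scheme $(\mathrm{Enc}^{\mathrm{Hope}},\mathrm{Dec}^{\mathrm{Hope}},\mathrm{EvalAdd}^{\mathrm{Hope}},\mathrm{EvalSub}^{\mathrm{Hope}})$ is IND-CPA secure. That is, consider any probabilistic polynomial time adversary $\mathcal A$ that is given $1^\kappa$, the public key $n$ and access to an encryption oracle $m\mapsto \mathrm{Enc}^{\mathrm{Hope}}(m)$, chooses two messages $m_0,m_1$, receives $c\gets\mathrm{Enc}^{\mathrm{Hope}}(m_b)$ for a uniformly random bit $b$, may continue to query the oracle (on any messages, including $m_0$ and $m_1$), and outputs a bit $b'$. Then $\big|\Pr[b'=b]-\tfrac12\big|$ is negligible in $\kappa$.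 -/

import Mathlib

noncomputable section

namespace Hope

/-! ### Probabilistic oracle programs with logarithmic cost

The machine model is a random access machine with integer registers, coin flips and one oracle.
Every elementary step is charged by the bit lengths of the integers it handles (the logarithmic
cost criterion), so that polynomial time agrees with polynomial time on Turing machines.
A bit string is presented to a program as the integer with that binary expansion. -/

/-- The memory: one integer per register. A program mentions only finitely many registers. -/
abbrev Mem := ℕ → ℤ

/-- The bit length of an integer. -/
def bits (z : ℤ) : ℕ := z.natAbs.size

/-- The arithmetic instructions. -/
inductive Op
  | add | sub | mul | div | mod

/-- Floor division and remainder for positive divisors (`a / 0 = 0` and `a % 0 = a`). -/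
def Op.eval : Op → ℤ → ℤ → ℤ
  | .add, a, b => a + b
  | .sub, a, b => a - b
  | .mul, a, b => a * b
  | .div, a, b => a / b
  | .mod, a, b => a % b

/-- Programs. Registers are named by natural numbers. -/
inductive Prog
  /-- do nothing -/
  | skip
  /-- `x := a` -/
  | const (x : ℕ) (a : ℤ)
  /-- `x := y op z` -/
  | arith (x : ℕ) (op : Op) (y z : ℕ)
  /-- `x :=` a fresh uniform random bit -/
  | flip (x : ℕ)
  /-- `x :=` the answer of the oracle to the content of `y` -/
  | query (x y : ℕ)
  /-- first `P`, then `Q` -/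
  | seq (P Q : Prog)
  /-- if `x > 0` then `P` else `Q` -/
  | ite (x : ℕ) (P Q : Prog)
  /-- while `x > 0` do `P` -/
  | loop (x : ℕ) (P : Prog)

/-- A memory together with the cost of the computation so far. -/
abbrev State := Mem × ℕ

/-- Write `a` into register `x`, at cost `c`. -/
def State.write (s : State) (x : ℕ) (a : ℤ) (c : ℕ) : State :=
  (Function.update s.1 x a, s.2 + c)

/-- Pay the cost of testing register `x`. -/
def State.test (s : State) (x : ℕ) : State := (s.1, s.2 + 1 + bits (s.1 x))

/-- Sequencing of random state transformers; `none` means that the computation was cut off. -/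
def andThen (d : PMF (Option State)) (f : State → PMF (Option State)) : PMF (Option State) :=
  d.bind fun o => o.elim (PMF.pure none) f

/-- The loop `while x > 0 do B`, cut off after the given number of tests. -/
def whileN (x : ℕ) (B : State → PMF (Option State)) : ℕ → State → PMF (Option State)
  | 0, _ => PMF.pure none
  | F + 1, s =>
    if 0 < s.1 x then andThen (B (s.test x)) (whileN x B F) else PMF.pure (some (s.test x))

/-- The distribution of the final state of a program run with oracle `O`, where every execution
of a loop is cut off after `F` tests. An oracle answers each query with fresh randomness. -/
def eval (O : ℤ → PMF ℤ) (F : ℕ) : Prog → State → PMF (Option State)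
  | .skip, s => PMF.pure (some (s.1, s.2 + 1))
  | .const x a, s => PMF.pure (some (s.write x a (1 + bits a)))
  | .arith x op y z, s =>
    PMF.pure (some (s.write x (op.eval (s.1 y) (s.1 z)) (1 + bits (s.1 y) + bits (s.1 z))))
  | .flip x, s =>
    (PMF.uniformOfFintype Bool).map fun b => some (s.write x (if b then 1 else 0) 1)
  | .query x y, s =>
    (O (s.1 y)).map fun a => some (s.write x a (1 + bits (s.1 y) + bits a))
  | .seq P Q, s => andThen (eval O F P s) (eval O F Q)
  | .ite x P Q, s => if 0 < s.1 x then eval O F P (s.test x) else eval O F Q (s.test x)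
  | .loop x P, s => whileN x (eval O F P) F s

open Classical in
/-- The distribution of the final memory and of the cost of `P` started on memory `m` with
oracle `O`, where `P` halts on all random choices within a common bound on its loops.
(The bound itself is irrelevant then; a program without such a bound is given the value `none`.) -/
def exec (O : ℤ → PMF ℤ) (P : Prog) (m : Mem) : PMF (Option State) :=
  if h : ∃ F, none ∉ (eval O F P (m, 0)).support then eval O h.choose P (m, 0)
  else PMF.pure none

/-- `P` is a probabilistic polynomial time program: there is a polynomial `p` such that, on all
inputs and with all oracles, if `L` bounds the lengths of the inputs and of the oracle answers,
`P` halts after cost at most `p(L)`, whatever the random choices. -/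
def PolyTime (P : Prog) : Prop :=
  ∃ p : Polynomial ℕ, ∀ (L : ℕ) (O : ℤ → PMF ℤ) (m : Mem),
    (∀ y, ∀ a ∈ (O y).support, bits a ≤ L) → (∀ x, bits (m x) ≤ L) →
      ∀ o ∈ (exec O P m).support, ∃ (m' : Mem) (t : ℕ), o = some (m', t) ∧ t ≤ p.eval L

/-- The oracle without information, for programs that are to have no oracle. -/
def noOracle : ℤ → PMF ℤ := fun _ => PMF.pure 0

/-- The memory with the inputs `l` in registers `0, 1, …`, and `0` elsewhere. -/
def inputs (l : List ℤ) : Mem := fun x => l.getD x 0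

/-- The string `1^κ`: the integer whose binary expansion consists of `κ` ones. -/
def unary (κ : ℕ) : ℤ := 2 ^ κ - 1

/-- The bit in a register: positive contents stand for `true`. -/
def bitOf (m : Mem) (x : ℕ) : Bool := decide (0 < m x)

/-- A function of the security parameter is negligible: it is eventually smaller than the inverse
of each polynomial. -/
def Negligible (f : ℕ → ℝ) : Prop :=
  Asymptotics.SuperpolynomialDecay Filter.atTop (fun κ : ℕ => (κ : ℝ)) f

/-- The probability that a random bit is `true`. -/
def prTrue (d : PMF Bool) : ℝ := (d true).toReal

/-! ### Homomorphic public-key schemes and the IND-CPA experiment -/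

/-- A public-key scheme for signed integers with homomorphic addition and subtraction. Public keys
are positive integers, secret keys and ciphertexts are natural numbers; encryption is randomized. -/
structure HomScheme where
  enc : ℕ+ → ℤ → PMF ℕ
  dec : ℕ+ → ℕ → ℕ → ℤ
  evalAdd : ℕ+ → ℕ → ℕ → ℕ
  evalSub : ℕ+ → ℕ → ℕ → ℕ

/-- The encryption oracle under a public key. -/
def HomScheme.oracle (S : HomScheme) (pk : ℕ+) : ℤ → PMF ℤ :=
  fun m => (S.enc pk m).map fun c => (c : ℤ)

/-- The IND-CPA experiment, with value `true` if the adversary `(A₁, A₂)` wins.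
A key pair is drawn. With access to an encryption oracle, `A₁` gets `1^κ` and the public key, and
leaves two messages in the registers `0` and `1`. One of them, chosen by a random bit `b`, is
encrypted. The ciphertext is put into register `0`, and `A₂` continues on the memory of `A₁`, with
access to the same oracle. The adversary wins if the bit that it leaves in register `0` is `b`.
The messages are neither restricted to a message space nor barred from being queried. -/
def indCPAExp (keys : ℕ → PMF (ℕ+ × ℕ)) (S : HomScheme) (A₁ A₂ : Prog) (κ : ℕ) : PMF Bool :=
  (keys κ).bind fun key =>
    (exec (S.oracle key.1) A₁ (inputs [unary κ, (key.1 : ℕ)])).bind fun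
      | none => PMF.pure false
      | some (m, _) =>
        (PMF.uniformOfFintype Bool).bind fun b =>
          (S.enc key.1 (if b then m 1 else m 0)).bind fun c =>
            (exec (S.oracle key.1) A₂ (Function.update m 0 (c : ℤ))).map fun
              | none => false
              | some (m', _) => bitOf m' 0 == b

/-- IND-CPA security: every probabilistic polynomial time adversary wins with probability at most
negligibly different from `1/2`. -/
def INDCPASecure (keys : ℕ → PMF (ℕ+ × ℕ)) (S : HomScheme) : Prop :=
  ∀ A₁ A₂ : Prog, PolyTime A₁ → PolyTime A₂ →
    Negligible fun κ => |prTrue (indCPAExp keys S A₁ A₂ κ) - 1 / 2|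

/-! ### Paillier and its signed extension -/

/-- The Paillier encryption `(n+1)^m r^n mod n²` of `m ∈ {0, …, n-1}`, with `r` uniform
in `(ℤ/nℤ)ˣ`. -/
def encPail (n : ℕ+) (m : ℕ) : PMF ℕ :=
  (PMF.uniformOfFintype (ZMod (n : ℕ))ˣ).map fun r =>
    (((n : ℕ) + 1) ^ m * (r : ZMod (n : ℕ)).val ^ (n : ℕ)) % (n : ℕ) ^ 2

/-- The Paillier decryption `(((c^φ mod n²) - 1) / n) · (φ⁻¹ mod n) mod n`. -/
def decPail (n : ℕ+) (φ : ℕ) (c : ℕ) : ℕ :=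
  ((c ^ φ % (n : ℕ) ^ 2 - 1) / (n : ℕ) * ((φ : ZMod (n : ℕ))⁻¹).val) % (n : ℕ)

/-- `Enc^Hope(m) = Enc^Pail(m mod n)`, intended for `-⌊n/2⌋ ≤ m < ⌊n/2⌋`. -/
def encHope (n : ℕ+) (m : ℤ) : PMF ℕ := encPail n (m % (n : ℕ)).toNat

/-- `Dec^Hope(c) = ((Dec^Pail(c) + ⌊n/2⌋) mod n) - ⌊n/2⌋`. -/
def decHope (n : ℕ+) (φ : ℕ) (c : ℕ) : ℤ :=
  (((decPail n φ c + (n : ℕ) / 2) % (n : ℕ) : ℕ) : ℤ) - (((n : ℕ) / 2 : ℕ) : ℤ)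

/-- Homomorphic addition `c₀ c₁ mod n²`. -/
def evalAddHope (n : ℕ+) (c₀ c₁ : ℕ) : ℕ := (c₀ * c₁) % (n : ℕ) ^ 2

/-- Homomorphic negation `c⁻¹ mod n²`. -/
def evalNegHope (n : ℕ+) (c : ℕ) : ℕ := ((c : ZMod ((n : ℕ) ^ 2))⁻¹).val

/-- Homomorphic subtraction: addition of the negation. -/
def evalSubHope (n : ℕ+) (c₀ c₁ : ℕ) : ℕ := evalAddHope n c₀ (evalNegHope n c₁)

/-- The quadruple `(Enc^Hope, Dec^Hope, EvalAdd^Hope, EvalSub^Hope)`. -/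
def hopeScheme : HomScheme where
  enc := encHope
  dec := decHope
  evalAdd := evalAddHope
  evalSub := evalSubHope

/-- The primes behind a Paillier modulus: distinct odd primes `p`, `q` with `p ∤ q - 1` and
`q ∤ p - 1`. -/
structure Primes where
  p : ℕ
  q : ℕ
  prime_p : p.Prime
  prime_q : q.Prime
  odd_p : Odd p
  odd_q : Odd q
  ne : p ≠ q
  not_dvd_left : ¬ p ∣ q - 1
  not_dvd_right : ¬ q ∣ p - 1

/-- The modulus `n = pq`. -/
def Primes.n (k : Primes) : ℕ+ := ⟨k.p * k.q, Nat.mul_pos k.prime_p.pos k.prime_q.pos⟩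

/-- Public key `n`, secret key `φ(n)`. -/
def Primes.keyPair (k : Primes) : ℕ+ × ℕ := (k.n, Nat.totient k.n)

/-! ### The decisional `n`-th residue problem -/

/-- A uniform element of `(ℤ/n²ℤ)ˣ`. -/
def uniformUnit (n : ℕ+) : PMF (ZMod ((n : ℕ) ^ 2))ˣ :=
  PMF.uniformOfFintype (ZMod ((n : ℕ) ^ 2))ˣ

/-- A uniform `n`-th residue modulo `n²`, that is `g^n` for a uniform `g` in `(ℤ/n²ℤ)ˣ`. -/
def uniformResidue (n : ℕ+) : PMF (ZMod ((n : ℕ) ^ 2))ˣ :=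
  (uniformUnit n).map fun g => g ^ (n : ℕ)

/-- The output bit of the program `D` on `1^κ`, on a random modulus `n`, and on an element of
`(ℤ/n²ℤ)ˣ` that is drawn according to `h n`. -/
def residueExp (gen : ℕ → PMF Primes) (h : ∀ n : ℕ+, PMF (ZMod ((n : ℕ) ^ 2))ˣ) (D : Prog)
    (κ : ℕ) : PMF Bool :=
  (gen κ).bind fun k =>
    (h k.n).bind fun x =>
      (exec noOracle D
        (inputs [unary κ, ((k.n : ℕ) : ℤ), ((x : ZMod ((k.n : ℕ) ^ 2)).val : ℤ)])).map fun
        | none => false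
        | some (m, _) => bitOf m 0

/-- The decisional `n`-th residue problem is intractable for the moduli drawn by `gen`: no
probabilistic polynomial time program distinguishes random `n`-th residues modulo `n²` from random
elements of `(ℤ/n²ℤ)ˣ`. -/
def NthResidueHard (gen : ℕ → PMF Primes) : Prop :=
  ∀ D : Prog, PolyTime D →
    Negligible fun κ =>
      |prTrue (residueExp gen uniformResidue D κ) - prTrue (residueExp gen uniformUnit D κ)|

end Hope

end

/-! The reduction is direct. Since `(n+1)^m ≡ 1 + mn` modulo `n²`, a ciphertext of `y` is `x (1 + (y
mod n) n)` with an `n`-th power `x`. Given `x` from the residue problem, a distinguisher runs the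
adversary, draws `b` itself, uses this product for the chosen message as the challenge, and outputs
whether the guess equals `b`.

If `x` is a uniform residue, the challenge is distributed exactly as an encryption: `g^n` modulo
`n²` depends only on `g` modulo `n`, and reduction of units is a surjective homomorphism, so it
preserves uniformity (`map_ciphertext_uniformResidue`). If `x` is a uniform unit, multiplication by
the unit `1 + (y mod n) n` permutes the units, so the challenge carries no information and the
adversary wins with probability exactly `1/2` (`map_ciphertext_uniformUnit`, `ex_game_const`).

The labour lies in making the distinguisher a program without oracle, with fair coins as its only
randomness. It must answer encryption queries itself and samples units by `κ` rounds of rejection. A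
round fails with probability at most `3/4` (`rejectProb_le`), so each answer is within `(3/4)^κ` of
a true encryption. A query costs at least one unit, and a hybrid argument that charges the error to
the cost (`hyb_eval`, `ex_exec_le`) bounds the total effect by `T (3/4)^κ` with `T` polynomial.
Hence the advantage is at most that of the distinguisher plus `T (3/4)^κ`.

The simulation shifts the adversary to the registers from `20` on and replaces queries by `encProg`.
Couplings (`cpl_encProg`, `simulates_subst`) show that outcomes are preserved and that the cost
grows by a polynomial factor; registers stay short because they lengthen at most as fast as the cost
(`grows_eval`). During the simulation, registers `0` to `3` hold `1^κ`, `n`, `x`, `b`; register `4`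
is for `n²`, registers `5` to `14` are work space, and `16`, `17`, `18` are for the constants `0`,
`1`, `2`, so that adding register `16` copies. -/

noncomputable section

namespace Hope

open scoped ENNReal

/-! ### Expectations -/

/-- The expectation of a nonnegative function under a discrete distribution. -/
def ex {α : Type*} (d : PMF α) (f : α → ℝ≥0∞) : ℝ≥0∞ := ∑' a, d a * f a

section Expectation

variable {α β : Type*}

theorem ex_pure (a : α) (f : α → ℝ≥0∞) : ex (PMF.pure a) f = f a := by
  classical
  unfold ex
  rw [tsum_eq_single a]
  · simp
  · intro b hb
    simp [PMF.pure_apply, hb]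

theorem ex_bind (d : PMF α) (g : α → PMF β) (f : β → ℝ≥0∞) :
    ex (d.bind g) f = ex d fun a => ex (g a) f := by
  unfold ex
  simp only [PMF.bind_apply, ← ENNReal.tsum_mul_right, ← ENNReal.tsum_mul_left]
  rw [ENNReal.tsum_comm]
  simp only [mul_assoc]

theorem ex_map (d : PMF α) (g : α → β) (f : β → ℝ≥0∞) : ex (d.map g) f = ex d fun a => f (g a) := by
  rw [← PMF.bind_pure_comp, ex_bind]
  simp [ex_pure]

theorem ex_const (d : PMF α) (c : ℝ≥0∞) : ex d (fun _ => c) = c := by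
  simp [ex, ENNReal.tsum_mul_right]

theorem ex_add (d : PMF α) (f g : α → ℝ≥0∞) : ex d (fun a => f a + g a) = ex d f + ex d g := by
  simp [ex, mul_add, ENNReal.tsum_add]

theorem ex_mono {d : PMF α} {f g : α → ℝ≥0∞} (h : ∀ a ∈ d.support, f a ≤ g a) :
    ex d f ≤ ex d g := by
  refine ENNReal.tsum_le_tsum fun a => ?_
  by_cases ha : d a = 0
  · simp [ha]
  · gcongr
    exact h a ha

theorem ex_congr {d : PMF α} {f g : α → ℝ≥0∞} (h : ∀ a ∈ d.support, f a = g a) :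
    ex d f = ex d g :=
  le_antisymm (ex_mono fun a ha => (h a ha).le) (ex_mono fun a ha => (h a ha).ge)

theorem ex_le_const {d : PMF α} {f : α → ℝ≥0∞} {c : ℝ≥0∞} (h : ∀ a ∈ d.support, f a ≤ c) :
    ex d f ≤ c :=
  (ex_mono h).trans (ex_const d c).le

theorem apply_eq_ex [DecidableEq α] (d : PMF α) (a : α) :
    d a = ex d fun b => if b = a then 1 else 0 := by
  simp [ex]

theorem ex_uniformOfFintype [Fintype α] [Nonempty α] (f : α → ℝ≥0∞) :
    ex (PMF.uniformOfFintype α) f = (Fintype.card α : ℝ≥0∞)⁻¹ * ∑ a, f a := by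
  simp [ex, tsum_fintype, Finset.mul_sum]

theorem map_uniformOfFintype_equiv [Fintype α] [Nonempty α] (e : α ≃ α) :
    (PMF.uniformOfFintype α).map e = PMF.uniformOfFintype α := by
  classical
  ext a
  rw [apply_eq_ex, ex_map, ex_uniformOfFintype]
  have : ∀ b, e b = a ↔ b = e.symm a := fun b => by rw [Equiv.eq_symm_apply]
  simp [this]

end Expectation

/-! ### Couplings of a distribution with the outcome of a computation -/

/-- The computation `e` never fails, and its outcome can be coupled with `d` such that `R` holds. -/
def Cpl {α : Type*} (d : PMF α) (e : PMF (Option State)) (R : α → State → Prop) : Prop :=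
  ∃ c : PMF (α × State), c.map Prod.fst = d ∧ c.map (fun p => some p.2) = e ∧
    ∀ p ∈ c.support, R p.1 p.2

section Coupling

variable {α β : Type*}

theorem andThen_pure (s : State) (f : State → PMF (Option State)) :
    andThen (PMF.pure (some s)) f = f s := by
  simp [andThen]

theorem andThen_map {γ : Type*} (c : PMF γ) (g : γ → State) (f : State → PMF (Option State)) :
    andThen (c.map fun x => some (g x)) f = c.bind fun x => f (g x) := by
  simp only [andThen, PMF.bind_map]
  rfl

theorem Cpl.pure {a : α} {s : State} {R : α → State → Prop} (h : R a s) :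
    Cpl (PMF.pure a) (PMF.pure (some s)) R := by
  refine ⟨PMF.pure (a, s), by simp [PMF.pure_map], by simp [PMF.pure_map], ?_⟩
  intro p hp
  rw [PMF.support_pure, Set.mem_singleton_iff] at hp
  subst hp
  exact h

theorem Cpl.mono {d : PMF α} {e : PMF (Option State)} {R R' : α → State → Prop}
    (h : Cpl d e R) (hR : ∀ a s, R a s → R' a s) : Cpl d e R' := by
  obtain ⟨c, h1, h2, h3⟩ := h
  exact ⟨c, h1, h2, fun p hp => hR _ _ (h3 p hp)⟩

/-- Inductions along a program need to know that the related states occur, since bounds on cost and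
length hold only for reachable states. -/
theorem Cpl.and_mem {d : PMF α} {e : PMF (Option State)} {R : α → State → Prop}
    (h : Cpl d e R) : Cpl d e fun a s => R a s ∧ a ∈ d.support ∧ some s ∈ e.support := by
  obtain ⟨c, h1, h2, h3⟩ := h
  refine ⟨c, h1, h2, fun p hp => ⟨h3 p hp, ?_, ?_⟩⟩
  · rw [← h1, PMF.support_map]
    exact ⟨p, hp, rfl⟩
  · rw [← h2, PMF.support_map]
    exact ⟨p, hp, rfl⟩

/-- The couplings of the continuations, one for each related pair, are glued along the first
coupling. Outside its support the chosen `q` is arbitrary, so marginals are compared only where `c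
p` is nonzero. -/
theorem Cpl.andThen {d : PMF α} {e : PMF (Option State)} {R : α → State → Prop}
    {f : α → PMF β} {g : State → PMF (Option State)} {R' : β → State → Prop}
    (h : Cpl d e R) (h' : ∀ a s, R a s → Cpl (f a) (g s) R') :
    Cpl (d.bind f) (Hope.andThen e g) R' := by
  classical
  obtain ⟨c, h1, h2, h3⟩ := h
  obtain ⟨p₀, hp₀⟩ := c.support_nonempty
  have : Nonempty (PMF (β × State)) := ⟨(h' _ _ (h3 p₀ hp₀)).choose⟩
  choose! q hq1 hq2 hq3 using h'
  refine ⟨c.bind fun p => q p.1 p.2, ?_, ?_, ?_⟩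
  · rw [PMF.map_bind, ← h1, PMF.bind_map]
    ext b
    simp only [PMF.bind_apply]
    refine tsum_congr fun p => ?_
    by_cases hp : c p = 0
    · simp [hp]
    · rw [hq1 _ _ (h3 p hp)]; rfl
  · rw [PMF.map_bind, ← h2, andThen_map]
    ext b
    simp only [PMF.bind_apply]
    refine tsum_congr fun p => ?_
    by_cases hp : c p = 0
    · simp [hp]
    · rw [hq2 _ _ (h3 p hp)]
  · intro p hp
    rw [PMF.mem_support_bind_iff] at hp
    obtain ⟨x, hx, hp⟩ := hp
    exact hq3 _ _ (h3 x hx) p hp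

theorem Cpl.map_fst {d : PMF α} {e : PMF (Option State)} {R : α → State → Prop}
    (h : Cpl d e R) (k : α → β) :
    Cpl (d.map k) e fun b s => ∃ a, R a s ∧ b = k a := by
  obtain ⟨c, h1, h2, h3⟩ := h
  refine ⟨c.map fun p => (k p.1, p.2), ?_, ?_, ?_⟩
  · rw [PMF.map_comp, ← h1, PMF.map_comp]; rfl
  · rw [PMF.map_comp, ← h2]; rfl
  · intro p hp
    rw [PMF.support_map] at hp
    obtain ⟨x, hx, rfl⟩ := hp
    exact ⟨_, h3 x hx, rfl⟩

theorem Cpl.none_notMem {d : PMF α} {e : PMF (Option State)} {R : α → State → Prop}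
    (h : Cpl d e R) : none ∉ e.support := by
  obtain ⟨c, h1, h2, h3⟩ := h
  rw [← h2, PMF.support_map]
  rintro ⟨x, _, hx⟩
  cases hx

theorem Cpl.exists_of_mem {d : PMF α} {e : PMF (Option State)} {R : α → State → Prop}
    (h : Cpl d e R) {o : Option State} (ho : o ∈ e.support) :
    ∃ a ∈ d.support, ∃ s, o = some s ∧ R a s := by
  obtain ⟨c, h1, h2, h3⟩ := h
  rw [← h2, PMF.support_map] at ho
  obtain ⟨x, hx, rfl⟩ := ho
  refine ⟨x.1, ?_, x.2, rfl, h3 x hx⟩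
  rw [← h1, PMF.support_map]
  exact ⟨x, hx, rfl⟩

/-- The distribution of an output that the coupling determines. -/
theorem Cpl.map_eq {d : PMF α} {e : PMF (Option State)} {R : α → State → Prop}
    (h : Cpl d e R) (φ : α → β) (ψ : Option State → β) (hR : ∀ a s, R a s → ψ (some s) = φ a) :
    e.map ψ = d.map φ := by
  obtain ⟨c, h1, h2, h3⟩ := h
  rw [← h1, ← h2, PMF.map_comp, PMF.map_comp, ← PMF.bind_pure_comp, ← PMF.bind_pure_comp]
  ext b
  simp only [PMF.bind_apply]
  refine tsum_congr fun p => ?_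
  by_cases hp : c p = 0
  · simp [hp]
  · simp [hR _ _ (h3 p hp)]

end Coupling

/-! ### Bit lengths -/

theorem bits_le_iff {z : ℤ} {k : ℕ} : bits z ≤ k ↔ z.natAbs < 2 ^ k := Nat.size_le

theorem bits_mono {a b : ℤ} (h : a.natAbs ≤ b.natAbs) : bits a ≤ bits b := Nat.size_le_size h

theorem bits_le_bits {a b : ℤ} (h0 : 0 ≤ a) (h : a ≤ b) : bits a ≤ bits b := bits_mono (by omega)

theorem natAbs_lt_two_pow_bits (z : ℤ) : z.natAbs < 2 ^ bits z := Nat.lt_size_self _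

theorem bits_add_le (a b : ℤ) : bits (a + b) ≤ max (bits a) (bits b) + 1 := by
  rw [bits_le_iff]
  have ha := (natAbs_lt_two_pow_bits a).trans_le
    (Nat.pow_le_pow_right two_pos (le_max_left (bits a) (bits b)))
  have hb := (natAbs_lt_two_pow_bits b).trans_le
    (Nat.pow_le_pow_right two_pos (le_max_right (bits a) (bits b)))
  have := Int.natAbs_add_le a b
  rw [pow_succ]
  omega

theorem bits_neg (a : ℤ) : bits (-a) = bits a := by simp [bits]

theorem bits_sub_le (a b : ℤ) : bits (a - b) ≤ max (bits a) (bits b) + 1 := by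
  rw [sub_eq_add_neg, ← bits_neg b]
  exact bits_add_le _ _

theorem bits_mul_le (a b : ℤ) : bits (a * b) ≤ bits a + bits b := by
  rw [bits_le_iff, Int.natAbs_mul, pow_add]
  exact Nat.mul_lt_mul'' (natAbs_lt_two_pow_bits a) (natAbs_lt_two_pow_bits b)

theorem bits_div_le (a b : ℤ) : bits (a / b) ≤ bits a := bits_mono (Int.natAbs_ediv_le_natAbs a b)

theorem bits_emod_le (a b : ℤ) : bits (a % b) ≤ max (bits a) (bits b) := by
  rcases eq_or_ne b 0 with rfl | hb
  · simp
  · have h1 := Int.emod_nonneg a hb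
    have h2 := Int.emod_lt_abs a hb
    refine (bits_mono ?_).trans (le_max_right _ _)
    rcases abs_cases b with h | h <;> omega

theorem Op.bits_eval_le (op : Op) (a b : ℤ) : bits (op.eval a b) ≤ 1 + bits a + bits b := by
  cases op with
  | add => exact (bits_add_le a b).trans (by simp; omega)
  | sub => exact (bits_sub_le a b).trans (by simp; omega)
  | mul => exact (bits_mul_le a b).trans (by omega)
  | div => exact (bits_div_le a b).trans (by omega)
  | mod => exact (bits_emod_le a b).trans (by simp; omega)

theorem bits_bool (b : Bool) : bits (if b then 1 else 0) ≤ 1 := by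
  cases b <;> simp [bits]

/-! ### The loop bound is immaterial -/

theorem none_notMem_andThen {d : PMF (Option State)} {f : State → PMF (Option State)} :
    none ∉ (andThen d f).support ↔
      none ∉ d.support ∧ ∀ s, some s ∈ d.support → none ∉ (f s).support := by
  unfold andThen
  rw [PMF.mem_support_bind_iff]
  constructor
  · intro h
    refine ⟨fun hn => h ⟨none, hn, by simp⟩, fun s hs hn => h ⟨some s, hs, hn⟩⟩
  · rintro ⟨h1, h2⟩ ⟨o, ho, hn⟩
    cases o with
    | none => exact h1 ho
    | some s => exact h2 s ho hn

theorem some_mem_andThen {d : PMF (Option State)} {f : State → PMF (Option State)} {s : State} :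
    some s ∈ (andThen d f).support ↔ ∃ s', some s' ∈ d.support ∧ some s ∈ (f s').support := by
  unfold andThen
  rw [PMF.mem_support_bind_iff]
  constructor
  · rintro ⟨o, ho, hs⟩
    cases o with
    | none => simp at hs
    | some s' => exact ⟨s', ho, hs⟩
  · rintro ⟨s', h1, h2⟩
    exact ⟨some s', h1, h2⟩

theorem andThen_congr {d : PMF (Option State)} {f f' : State → PMF (Option State)}
    (h : ∀ s, some s ∈ d.support → f s = f' s) : andThen d f = andThen d f' := by
  ext o
  simp only [andThen, PMF.bind_apply]
  refine tsum_congr fun a => ?_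
  by_cases ha : d a = 0
  · simp [ha]
  · cases a with
    | none => rfl
    | some s => simp [h s ha]

/-- `B'` stands for the body run with a larger bound on its inner loops, so that both bounds may
increase at once. -/
theorem whileN_mono {x : ℕ} {B B' : State → PMF (Option State)}
    (hB : ∀ s, none ∉ (B s).support → B' s = B s) {N N' : ℕ} (hN : N ≤ N') {s : State}
    (h : none ∉ (whileN x B N s).support) : whileN x B' N' s = whileN x B N s := by
  induction N generalizing N' s with
  | zero => simp [whileN] at h
  | succ N ih =>
    obtain ⟨N', rfl⟩ : ∃ k, N' = k + 1 := ⟨N' - 1, by omega⟩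
    simp only [whileN] at h ⊢
    split_ifs at h ⊢ with hx
    · rw [none_notMem_andThen] at h
      rw [hB _ h.1]
      exact andThen_congr fun s' hs' => ih (by omega) (h.2 s' hs')
    · rfl

/-- If no outcome is cut off, no loop has exhausted its bound, and raising the bound changes
nothing. This makes the choice of the bound in `exec` harmless. -/
theorem eval_mono {O : ℤ → PMF ℤ} {F F' : ℕ} (hF : F ≤ F') (P : Prog) {s : State}
    (h : none ∉ (eval O F P s).support) : eval O F' P s = eval O F P s := by
  induction P generalizing s with
  | skip | const | arith | flip | query => rfl
  | seq P Q ihP ihQ =>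
    simp only [eval] at h ⊢
    rw [none_notMem_andThen] at h
    rw [ihP h.1]
    exact andThen_congr fun s' hs' => ihQ (h.2 s' hs')
  | ite x P Q ihP ihQ =>
    simp only [eval] at h ⊢
    split_ifs at h ⊢
    · exact ihP h
    · exact ihQ h
  | loop x P ih =>
    simp only [eval] at h ⊢
    exact whileN_mono (fun s hs => ih hs) hF h

theorem exec_eq_eval {O : ℤ → PMF ℤ} {F : ℕ} {P : Prog} {m : Mem}
    (h : none ∉ (eval O F P (m, 0)).support) : exec O P m = eval O F P (m, 0) := by
  have h' : ∃ F, none ∉ (eval O F P (m, 0)).support := ⟨F, h⟩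
  rw [exec, dif_pos h']
  rw [← eval_mono (le_max_left F h'.choose) P h,
    ← eval_mono (le_max_right F h'.choose) P h'.choose_spec]

theorem exists_exec_eq {O : ℤ → PMF ℤ} {P : Prog} {m : Mem} (h : none ∉ (exec O P m).support) :
    ∃ F₀, ∀ F ≥ F₀, exec O P m = eval O F P (m, 0) := by
  by_cases h' : ∃ F, none ∉ (eval O F P (m, 0)).support
  · obtain ⟨F₀, h₀⟩ := h'
    refine ⟨F₀, fun F hF => ?_⟩
    rw [exec_eq_eval h₀, eval_mono hF P h₀]
  · rw [exec, dif_neg h'] at h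
    simp at h

/-! ### Growth of the memory -/

/-- A bound on all registers. -/
def Bdd (m : Mem) (b : ℕ) : Prop := ∀ i, bits (m i) ≤ b

/-- From `s` to `s'` the cost grows, and the registers grow at most as much as the cost. -/
def Grows (s s' : State) : Prop :=
  s.2 ≤ s'.2 ∧ ∀ L, Bdd s.1 (L + s.2) → Bdd s'.1 (L + s'.2)

theorem Grows.trans {s s' s'' : State} (h : Grows s s') (h' : Grows s' s'') : Grows s s'' :=
  ⟨h.1.trans h'.1, fun L hL => h'.2 L (h.2 L hL)⟩

theorem grows_write {s : State} {x : ℕ} {a : ℤ} {c : ℕ} (h : bits a ≤ c) :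
    Grows s (s.write x a c) := by
  refine ⟨Nat.le_add_right _ _, fun L hL i => ?_⟩
  have := hL i
  simp only [State.write, Function.update_apply]
  split_ifs <;> omega

theorem grows_pay (s : State) (c : ℕ) : Grows s (s.1, s.2 + c) :=
  ⟨Nat.le_add_right _ _, fun L hL i => (hL i).trans (by simp)⟩

theorem grows_test (s : State) (x : ℕ) : Grows s (s.test x) := by
  rw [State.test, add_assoc]
  exact grows_pay s _

theorem grows_whileN {x : ℕ} {B : State → PMF (Option State)}
    (hB : ∀ s s', some s' ∈ (B s).support → Grows s s') {N : ℕ} {s s' : State}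
    (h : some s' ∈ (whileN x B N s).support) : Grows s s' := by
  induction N generalizing s with
  | zero => simp [whileN] at h
  | succ N ih =>
    simp only [whileN] at h
    split_ifs at h
    · obtain ⟨s₁, h1, h2⟩ := some_mem_andThen.1 h
      exact (grows_test s x).trans ((hB _ _ h1).trans (ih h2))
    · simp only [PMF.support_pure, Set.mem_singleton_iff, Option.some.injEq] at h
      subst h
      exact grows_test s x

/-- Every instruction that writes is charged at least the length of what it writes; for arithmetic,
the lengths of the operands plus one suffice. -/
theorem grows_eval {O : ℤ → PMF ℤ} {F : ℕ} {P : Prog} {s s' : State}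
    (h : some s' ∈ (eval O F P s).support) : Grows s s' := by
  induction P generalizing s s' with
  | skip =>
    simp only [eval, PMF.support_pure, Set.mem_singleton_iff, Option.some.injEq] at h
    subst h
    exact grows_pay s 1
  | const x a =>
    simp only [eval, PMF.support_pure, Set.mem_singleton_iff, Option.some.injEq] at h
    subst h
    exact grows_write (by omega)
  | arith x op y z =>
    simp only [eval, PMF.support_pure, Set.mem_singleton_iff, Option.some.injEq] at h
    subst h
    exact grows_write (op.bits_eval_le _ _)
  | flip x =>
    simp only [eval, PMF.support_map] at h
    obtain ⟨b, _, h⟩ := h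
    simp only [Option.some.injEq] at h
    subst h
    exact grows_write (bits_bool b)
  | query x y =>
    simp only [eval, PMF.support_map] at h
    obtain ⟨b, _, h⟩ := h
    simp only [Option.some.injEq] at h
    subst h
    exact grows_write (by omega)
  | seq P Q ihP ihQ =>
    obtain ⟨s₁, h1, h2⟩ := some_mem_andThen.1 h
    exact (ihP h1).trans (ihQ h2)
  | ite x P Q ihP ihQ =>
    simp only [eval] at h
    split_ifs at h
    · exact (grows_test s x).trans (ihP h)
    · exact (grows_test s x).trans (ihQ h)
  | loop x P ih => exact grows_whileN (fun s s' h => ih h) h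

/-! ### Exchanging the oracle -/

/-- The cost in units of `ε`; a computation that is cut off has infinite cost. -/
def wcost (ε : ℝ≥0∞) (o : Option State) : ℝ≥0∞ := o.elim ⊤ fun s => ε * s.2

/-- The expectations of `E` and `E'` differ by at most `ε` per unit of the cost under `E'`. -/
def Hyb (ε : ℝ≥0∞) (E E' : State → PMF (Option State)) : Prop :=
  ∀ (s : State) (f : Option State → ℝ≥0∞), (∀ o, f o ≤ 1) →
    ex (E s) f + ε * s.2 ≤ ex (E' s) fun o => f o + wcost ε o

theorem ex_andThen (d : PMF (Option State)) (g : State → PMF (Option State))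
    (f : Option State → ℝ≥0∞) :
    ex (andThen d g) f = ex d fun o => o.elim (f none) fun s => ex (g s) f := by
  rw [andThen, ex_bind]
  congr 1
  funext o
  cases o <;> simp [ex_pure]

/-- The first comparison is applied to the expectation over the second half, which is again a
function bounded by one. Costs are cumulative, so the term `ε * s'.2` it produces is the one that
the second comparison absorbs. -/
theorem Hyb.andThen {ε : ℝ≥0∞} {E₁ E₁' E₂ E₂' : State → PMF (Option State)}
    (h₁ : Hyb ε E₁ E₁') (h₂ : Hyb ε E₂ E₂') :
    Hyb ε (fun s => Hope.andThen (E₁ s) E₂) (fun s => Hope.andThen (E₁' s) E₂') := by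
  intro s f hf
  rw [ex_andThen, ex_andThen]
  refine (h₁ s _ ?_).trans (ex_mono ?_)
  · intro o
    cases o with
    | none => exact hf none
    | some s' => exact ex_le_const fun o _ => hf o
  · intro o _
    cases o with
    | none => rfl
    | some s' => exact h₂ s' f hf

theorem hyb_of_pay {ε : ℝ≥0∞} {E E' : State → PMF (Option State)} (h : Hyb ε E E')
    {s s' : State} (hs : s.2 ≤ s'.2) {f : Option State → ℝ≥0∞} (hf : ∀ o, f o ≤ 1) :
    ex (E s') f + ε * s.2 ≤ ex (E' s') fun o => f o + wcost ε o := by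
  refine le_trans ?_ (h s' f hf)
  gcongr

theorem hyb_pure {ε : ℝ≥0∞} {s s' : State} (hs : s.2 ≤ s'.2) (f : Option State → ℝ≥0∞) :
    ex (PMF.pure (some s')) f + ε * s.2 ≤ ex (PMF.pure (some s')) fun o => f o + wcost ε o := by
  rw [ex_pure, ex_pure]
  simp only [wcost, Option.elim_some]
  gcongr

theorem Hyb.whileN {ε : ℝ≥0∞} {E E' : State → PMF (Option State)} (h : Hyb ε E E') (x N : ℕ) :
    Hyb ε (Hope.whileN x E N) (Hope.whileN x E' N) := by
  induction N with
  | zero =>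
    intro s f hf
    -- A computation that is cut off has infinite weighted cost, so the right side is `⊤`.
    simp [Hope.whileN, ex_pure, wcost]
  | succ N ih =>
    intro s f hf
    simp only [Hope.whileN]
    split_ifs
    · exact hyb_of_pay (h.andThen ih) (grows_test s x).1 hf
    · exact hyb_pure (grows_test s x).1 f

/-- Only a query can tell the oracles apart. It costs at least one unit, and that unit pays for the
error `ε`. -/
theorem hyb_eval {ε : ℝ≥0∞} {O O' : ℤ → PMF ℤ}
    (hO : ∀ y (f : ℤ → ℝ≥0∞), (∀ a, f a ≤ 1) → ex (O y) f ≤ ex (O' y) f + ε) (F : ℕ) (P : Prog) :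
    Hyb ε (eval O F P) (eval O' F P) := by
  induction P with
  | skip => exact fun s f _ => hyb_pure (Nat.le_add_right _ _) f
  | const x a => exact fun s f _ => hyb_pure (Nat.le_add_right _ _) f
  | arith x op y z => exact fun s f _ => hyb_pure (Nat.le_add_right _ _) f
  | flip x =>
    intro s f hf
    simp only [eval, ex_map, ex_add]
    gcongr
    refine (ex_const (PMF.uniformOfFintype Bool) _).symm.le.trans (ex_mono fun b _ => ?_)
    simp only [wcost, Option.elim_some, State.write]
    gcongr
    omega
  | query x y =>
    intro s f hf
    simp only [eval, ex_map, ex_add]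
    refine (add_le_add_left (hO (s.1 y) _ fun a => hf _) _).trans ?_
    rw [add_assoc]
    gcongr
    refine (ex_const (O' (s.1 y)) _).symm.le.trans (ex_mono fun b _ => ?_)
    simp only [wcost, Option.elim_some, State.write]
    calc ε + ε * (s.2 : ℝ≥0∞) = ε * ((s.2 + 1 : ℕ) : ℝ≥0∞) := by push_cast; ring
      _ ≤ _ := by gcongr; omega
  | seq P Q ihP ihQ => exact ihP.andThen ihQ
  | ite x P Q ihP ihQ =>
    intro s f hf
    simp only [eval]
    split_ifs
    · exact hyb_of_pay ihP (grows_test s x).1 hf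
    · exact hyb_of_pay ihQ (grows_test s x).1 hf
  | loop x P ih => exact ih.whileN x F

/-- A program that halts within cost `T` is not much affected by a small change of the oracle. -/
theorem ex_exec_le {ε : ℝ≥0∞} {O O' : ℤ → PMF ℤ}
    (hO : ∀ y (f : ℤ → ℝ≥0∞), (∀ a, f a ≤ 1) → ex (O y) f ≤ ex (O' y) f + ε) {P : Prog} {m : Mem}
    {T : ℕ} (h : none ∉ (exec O P m).support)
    (h' : ∀ o ∈ (exec O' P m).support, ∃ (m' : Mem) (t : ℕ), o = some (m', t) ∧ t ≤ T)
    {f : Option State → ℝ≥0∞} (hf : ∀ o, f o ≤ 1) :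
    ex (exec O P m) f ≤ ex (exec O' P m) f + ε * T := by
  have hn' : none ∉ (exec O' P m).support := by
    intro hn
    obtain ⟨_, _, h0, _⟩ := h' _ hn
    cases h0
  obtain ⟨F, hF⟩ := exists_exec_eq h
  obtain ⟨F', hF'⟩ := exists_exec_eq hn'
  have key := hyb_eval hO (max F F') P (m, 0) f hf
  rw [← hF _ (le_max_left _ _), ← hF' _ (le_max_right _ _)] at key
  refine le_trans (by simp) (key.trans ?_)
  rw [ex_add]
  gcongr
  refine ex_le_const fun o ho => ?_
  obtain ⟨m', t, rfl, ht⟩ := h' o ho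
  simp only [wcost, Option.elim_some]
  gcongr

/-! ### Replacing the oracle by a subroutine -/

/-- The program `P` on the registers `20, 21, …`, with the queries `x ← O(y)` replaced by `S x y`. -/
def Prog.subst (S : ℕ → ℕ → Prog) : Prog → Prog
  | .skip => .skip
  | .const x a => .const (x + 20) a
  | .arith x op y z => .arith (x + 20) op (y + 20) (z + 20)
  | .flip x => .flip (x + 20)
  | .query x y => S x y
  | .seq P Q => .seq (P.subst S) (Q.subst S)
  | .ite x P Q => .ite (x + 20) (P.subst S) (Q.subst S)
  | .loop x P => .loop (x + 20) (P.subst S)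

/-- All outcomes are successful and have cost at most `T`. -/
def Tame (T : ℕ) (d : PMF (Option State)) : Prop :=
  ∀ o ∈ d.support, ∃ s, o = some s ∧ s.2 ≤ T

theorem Tame.none_notMem {T : ℕ} {d : PMF (Option State)} (h : Tame T d) : none ∉ d.support := by
  intro hn
  obtain ⟨_, h0, _⟩ := h _ hn
  cases h0

theorem Tame.andThen_right {T : ℕ} {d : PMF (Option State)} {f : State → PMF (Option State)}
    (h : Tame T (andThen d f)) {s : State} (hs : some s ∈ d.support) : Tame T (f s) := by
  intro o ho
  cases o with
  | none => exact absurd ho ((none_notMem_andThen.1 h.none_notMem).2 s hs)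
  | some s' => exact h _ (some_mem_andThen.2 ⟨s, hs, ho⟩)

theorem Tame.le_of_grows {T : ℕ} {d : PMF (Option State)} (h : Tame T d) {s : State}
    (hd : ∀ s', some s' ∈ d.support → Grows s s') : s.2 ≤ T := by
  obtain ⟨o, ho⟩ := d.support_nonempty
  obtain ⟨s', rfl, hs'⟩ := h o ho
  exact (hd _ ho).1.trans hs'

theorem Tame.andThen_left {T : ℕ} {d : PMF (Option State)} {f : State → PMF (Option State)}
    (h : Tame T (andThen d f)) (hf : ∀ s s', some s' ∈ (f s).support → Grows s s') :
    Tame T d := by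
  intro o ho
  cases o with
  | none => exact absurd ho (none_notMem_andThen.1 h.none_notMem).1
  | some s => exact ⟨s, rfl, (h.andThen_right ho).le_of_grows (hf s)⟩

/-- The memory of the simulated program is shifted, and the registers below satisfy `G`. -/
def SimRel (G : Mem → Prop) (m m' : Mem) : Prop := G m' ∧ ∀ i, m' (i + 20) = m i

/-- Simulation of a computation of cost at most `T`, where one unit of cost becomes at most `K`. -/
def Simulates (G : Mem → Prop) (K L T : ℕ) (E E' : State → PMF (Option State)) : Prop :=
  ∀ s s' : State, Tame T (E s) → Bdd s.1 (L + s.2) → SimRel G s.1 s'.1 →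
    Cpl (E s) (E' s') fun o r' => ∃ r, o = some r ∧ SimRel G r.1 r'.1 ∧
      r'.2 + K * s.2 ≤ s'.2 + K * r.2

section Simulation

variable {G : Mem → Prop} {K L T : ℕ} {E₁ E₁' E₂ E₂' : State → PMF (Option State)}

theorem Simulates.andThen (h₁ : Simulates G K L T E₁ E₁') (h₂ : Simulates G K L T E₂ E₂')
    (g₁ : ∀ s s', some s' ∈ (E₁ s).support → Grows s s')
    (g₂ : ∀ s s', some s' ∈ (E₂ s).support → Grows s s') :
    Simulates G K L T (fun s => Hope.andThen (E₁ s) E₂) fun s => Hope.andThen (E₁' s) E₂' := by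
  intro s s' hT hb hr
  refine (h₁ s s' (hT.andThen_left g₂) hb hr).and_mem.andThen ?_
  rintro o r' ⟨⟨r, rfl, hr', hc⟩, hmem, -⟩
  refine (h₂ r r' (hT.andThen_right hmem) ((g₁ _ _ hmem).2 _ hb) hr').mono ?_
  rintro o q' ⟨q, rfl, hq, hc'⟩
  exact ⟨q, rfl, hq, by omega⟩

theorem Simulates.test (hK : 1 ≤ K) (h : Simulates G K L T E₁ E₁') {s s' : State}
    {x : ℕ} (hT : Tame T (E₁ (s.test x))) (hb : Bdd s.1 (L + s.2)) (hr : SimRel G s.1 s'.1) :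
    Cpl (E₁ (s.test x)) (E₁' (s'.test (x + 20))) fun o r' =>
      ∃ r, o = some r ∧ SimRel G r.1 r'.1 ∧ r'.2 + K * s.2 ≤ s'.2 + K * r.2 := by
  refine (h (s.test x) (s'.test (x + 20)) hT ((grows_test s x).2 _ hb) hr).mono ?_
  rintro o r' ⟨r, rfl, hr', hc⟩
  refine ⟨r, rfl, hr', ?_⟩
  simp only [State.test, hr.2] at hc
  have : 1 + bits (s.1 x) ≤ K * (1 + bits (s.1 x)) := Nat.le_mul_of_pos_left _ hK
  rw [add_assoc s.2, mul_add] at hc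
  omega

theorem simulates_pure (hK : 1 ≤ K) {s s' : State} {m m' : Mem} {c : ℕ} (h : SimRel G m m') :
    Cpl (PMF.pure (some (m, s.2 + c))) (PMF.pure (some (m', s'.2 + c))) fun o r' =>
      ∃ r, o = some r ∧ SimRel G r.1 r'.1 ∧ r'.2 + K * s.2 ≤ s'.2 + K * r.2 := by
  refine Cpl.pure ⟨_, rfl, h, ?_⟩
  have : c ≤ K * c := Nat.le_mul_of_pos_left _ hK
  simp only [mul_add]
  omega

theorem Simulates.whileN (hK : 1 ≤ K) (h : Simulates G K L T E₁ E₁')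
    (g₁ : ∀ s s', some s' ∈ (E₁ s).support → Grows s s') (x : ℕ) {N N' : ℕ} (hN : N ≤ N') :
    Simulates G K L T (Hope.whileN x E₁ N) (Hope.whileN (x + 20) E₁' N') := by
  induction N generalizing N' with
  | zero =>
    intro s s' hT
    -- Tameness excludes a loop that is cut off before its first test.
    exact absurd (by simp [Hope.whileN]) hT.none_notMem
  | succ N ih =>
    intro s s' hT hb hr
    obtain ⟨N', rfl⟩ : ∃ k, N' = k + 1 := ⟨N' - 1, by omega⟩
    simp only [Hope.whileN, hr.2] at hT ⊢
    split_ifs at hT ⊢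
    · exact Simulates.test hK (h.andThen (ih (by omega)) g₁ fun s s' => grows_whileN g₁) hT hb hr
    · rw [State.test, State.test, hr.2, add_assoc, add_assoc]
      exact simulates_pure hK hr

theorem SimRel.update (hG : ∀ m m' : Mem, (∀ i < 20, m' i = m i) → G m → G m') {m m' : Mem}
    (h : SimRel G m m') (x : ℕ) (a : ℤ) :
    SimRel G (Function.update m x a) (Function.update m' (x + 20) a) := by
  refine ⟨hG m' _ (fun i hi => ?_) h.1, fun i => ?_⟩
  · rw [Function.update_of_ne (by omega)]
  · simp only [Function.update_apply, h.2 i, Nat.add_right_cancel_iff]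

theorem cpl_flip {O : ℤ → PMF ℤ} {F : ℕ} (x : ℕ) (s : State) :
    Cpl (PMF.uniformOfFintype Bool) (eval O F (.flip x) s) fun a r =>
      r = s.write x (if a then 1 else 0) 1 := by
  refine ⟨(PMF.uniformOfFintype Bool).map fun a => (a, s.write x (if a then 1 else 0) 1), ?_, ?_, ?_⟩
  · rw [PMF.map_comp]
    exact PMF.map_id _
  · rw [PMF.map_comp]
    rfl
  · intro p hp
    rw [PMF.support_map] at hp
    obtain ⟨a, _, rfl⟩ := hp
    rfl

/-- All instructions but queries act alike on the shifted registers, at the same cost. A query costs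
at least one, so the factor `K` pays for the subroutine. The property `G` depends only on the
registers below `20`, which shifted instructions leave alone, and `b` bounds the registers
throughout a run because their lengths never exceed `L` plus the cost. -/
theorem simulates_subst (hG : ∀ m m' : Mem, (∀ i < 20, m' i = m i) → G m → G m') (hK : 1 ≤ K)
    {O O' : ℤ → PMF ℤ} {F F' b : ℕ} (hF : F ≤ F') (hb : L + T ≤ b) {S : ℕ → ℕ → Prog}
    (hS : ∀ x y m t, G m → (∀ i, bits (m (i + 20)) ≤ b) →
      Cpl (O (m (y + 20))) (eval O' F' (S x y) (m, t)) fun a r =>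
        G r.1 ∧ (∀ i, r.1 (i + 20) = if i = x then a else m (i + 20)) ∧ r.2 ≤ t + K) (P : Prog) :
    Simulates G K L T (eval O F P) (eval O' F' (P.subst S)) := by
  induction P with
  | skip => exact fun s s' _ _ hr => simulates_pure hK hr
  | const x a => exact fun s s' _ _ hr => simulates_pure hK (hr.update hG x a)
  | arith x op y z =>
    intro s s' _ _ hr
    simp only [Prog.subst, eval, hr.2, State.write, add_assoc]
    exact simulates_pure hK (hr.update hG x _)
  | flip x =>
    intro s s' _ _ hr
    refine ((cpl_flip (x + 20) s').map_fst fun a => some (s.write x (if a then 1 else 0) 1)).mono ?_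
    rintro o r ⟨a, rfl, rfl⟩
    refine ⟨_, rfl, hr.update hG x _, ?_⟩
    simp only [State.write, mul_add]
    omega
  | query x y =>
    intro s s' hT hbd hr
    have hsT : s.2 ≤ T := hT.le_of_grows fun r hmem => grows_eval hmem
    have h := hS x y s'.1 s'.2 hr.1 fun i => by
      rw [hr.2]
      exact (hbd i).trans (by omega)
    rw [hr.2] at h
    refine (h.map_fst fun a => some (s.write x a (1 + bits (s.1 y) + bits a))).mono ?_
    rintro o r ⟨a, ⟨h1, h2, h3⟩, rfl⟩
    refine ⟨_, rfl, ⟨h1, fun i => ?_⟩, ?_⟩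
    · simp only [h2, State.write, Function.update_apply, hr.2]
    · have : K ≤ K * (1 + bits (s.1 y) + bits a) := Nat.le_mul_of_pos_right _ (by omega)
      simp only [State.write, mul_add K s.2]
      omega
  | seq P Q ihP ihQ => exact ihP.andThen ihQ (fun _ _ => grows_eval) fun _ _ => grows_eval
  | ite x P Q ihP ihQ =>
    intro s s' hT hbd hr
    simp only [Prog.subst, eval, hr.2] at hT ⊢
    split_ifs at hT ⊢
    · exact ihP.test hK hT hbd hr
    · exact ihQ.test hK hT hbd hr
  | loop x P ih => exact ih.whileN hK (fun _ _ => grows_eval) x hF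

end Simulation

/-! ### Straight-line code -/

/-- An arithmetic instruction `x := y op z`. -/
structure Ins where
  x : ℕ
  op : Op
  y : ℕ
  z : ℕ

/-- The program that performs a list of arithmetic instructions. -/
def block : List Ins → Prog
  | [] => .skip
  | i :: l => .seq (.arith i.x i.op i.y i.z) (block l)

/-- The effect of a list of arithmetic instructions on the memory. -/
def run : List Ins → Mem → Mem
  | [], m => m
  | i :: l, m => run l (Function.update m i.x (i.op.eval (m i.y) (m i.z)))

/-- The computation `e` is deterministic, adds at most `C` to the cost `t`, and ends in a memory
with the property `Q`. -/
def Det (e : PMF (Option State)) (t C : ℕ) (Q : Mem → Prop) : Prop :=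
  ∃ m c, e = PMF.pure (some (m, t + c)) ∧ c ≤ C ∧ Q m

theorem Bdd.update {m : Mem} {b : ℕ} (h : Bdd m b) (x : ℕ) {a : ℤ} (ha : bits a ≤ b) :
    Bdd (Function.update m x a) b := by
  intro i
  rw [Function.update_apply]
  split_ifs
  exacts [ha, h i]

theorem Bdd.mono {m : Mem} {b b' : ℕ} (h : Bdd m b) (hb : b ≤ b') : Bdd m b' :=
  fun i => (h i).trans hb

section Det

variable {O : ℤ → PMF ℤ} {F : ℕ} {m : Mem} {t : ℕ}

theorem Det.mono {e : PMF (Option State)} {C C' : ℕ} {Q Q' : Mem → Prop} (h : Det e t C Q)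
    (hC : C ≤ C') (hQ : ∀ m, Q m → Q' m) : Det e t C' Q' := by
  obtain ⟨m, c, h1, h2, h3⟩ := h
  exact ⟨m, c, h1, h2.trans hC, hQ m h3⟩

theorem Det.andThen {e : PMF (Option State)} {f : State → PMF (Option State)} {C C' : ℕ}
    {Q Q' : Mem → Prop} (h : Det e t C Q) (h' : ∀ m t, Q m → Det (f (m, t)) t C' Q') :
    Det (andThen e f) t (C + C') Q' := by
  obtain ⟨m, c, rfl, hc, hQ⟩ := h
  obtain ⟨m', c', h1, hc', hQ'⟩ := h' m (t + c) hQ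
  exact ⟨m', c + c', by rw [andThen_pure, h1, add_assoc], by omega, hQ'⟩

theorem Det.ite {x : ℕ} {P Q : Prog} {C B : ℕ} {R : Mem → Prop} (hb : Bdd m B)
    (h1 : 0 < m x → ∀ t, Det (eval O F P (m, t)) t C R)
    (h2 : ¬ 0 < m x → ∀ t, Det (eval O F Q (m, t)) t C R) :
    Det (eval O F (.ite x P Q) (m, t)) t (1 + B + C) R := by
  have hx := hb x
  simp only [eval]
  split_ifs with h
  · obtain ⟨m', c, h1, h2, h3⟩ := h1 h (t + 1 + bits (m x))
    exact ⟨m', 1 + bits (m x) + c, by rw [State.test, h1]; congr 3; omega, by omega, h3⟩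
  · obtain ⟨m', c, h1, h2, h3⟩ := h2 h (t + 1 + bits (m x))
    exact ⟨m', 1 + bits (m x) + c, by rw [State.test, h1]; congr 3; omega, by omega, h3⟩

theorem Det.skip {C : ℕ} (hC : 1 ≤ C) {R : Mem → Prop} (h : R m) :
    Det (eval O F .skip (m, t)) t C R := ⟨m, 1, rfl, hC, h⟩

theorem Det.while_stop {x N B C : ℕ} {E : State → PMF (Option State)} (hb : Bdd m B)
    (hN : 1 ≤ N) (hC : 1 + B ≤ C) (hx : ¬ 0 < m x) {R : Mem → Prop} (h : R m) :
    Det (whileN x E N (m, t)) t C R := by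
  obtain ⟨N, rfl⟩ : ∃ k, N = k + 1 := ⟨N - 1, by omega⟩
  have := hb x
  refine ⟨m, 1 + bits (m x), ?_, by omega, h⟩
  rw [whileN, if_neg hx, State.test, add_assoc]

theorem Det.while_step {x N B C C' : ℕ} {E : State → PMF (Option State)} (hb : Bdd m B)
    (hx : 0 < m x) {Q R : Mem → Prop} (h : ∀ t, Det (E (m, t)) t C Q)
    (h' : ∀ m t, Q m → Det (whileN x E N (m, t)) t C' R) :
    Det (whileN x E (N + 1) (m, t)) t (1 + B + C + C') R := by
  have := hb x
  obtain ⟨m', c, h1, h2, h3⟩ := (h (t + (1 + bits (m x)))).andThen h'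
  refine ⟨m', 1 + bits (m x) + c, ?_, by omega, h3⟩
  rw [whileN, if_pos hx, State.test, add_assoc, h1, add_assoc]

/-- One instruction turns the bound `B` into at most `2 * B + 1`, that is, it doubles `B + 1`, so
the costs form a geometric sum. The summand `2 * (B + 1)` on the left lets the induction close. -/
theorem det_block_aux {B : ℕ} (hb : Bdd m B) (l : List Ins) :
    ∃ c, eval O F (block l) (m, t) = PMF.pure (some (run l m, t + c)) ∧
      c + 2 * (B + 1) ≤ 2 ^ (l.length + 1) * (2 * (B + 1)) := by
  induction l generalizing m t B with
  | nil => exact ⟨1, rfl, by simp; omega⟩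
  | cons i l ih =>
    have h1 := hb i.y
    have h2 := hb i.z
    have hb' : Bdd (Function.update m i.x (i.op.eval (m i.y) (m i.z))) (2 * B + 1) :=
      Bdd.update (hb.mono (by omega)) _ ((i.op.bits_eval_le _ _).trans (by omega))
    obtain ⟨c, h3, h4⟩ := ih (t := t + (1 + bits (m i.y) + bits (m i.z))) hb'
    refine ⟨1 + bits (m i.y) + bits (m i.z) + c, ?_, ?_⟩
    · simp only [block, eval, andThen_pure, State.write, run]
      rw [h3, add_assoc t]
    · have : 2 ^ ((i :: l).length + 1) * (2 * (B + 1)) =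
          2 ^ (l.length + 1) * (2 * (2 * B + 1 + 1)) := by
        rw [List.length_cons, pow_succ _ (l.length + 1)]
        ring
      omega

theorem det_block {B : ℕ} (hb : Bdd m B) {l : List Ins} (hl : l.length ≤ 6) :
    Det (eval O F (block l) (m, t)) t (256 * (B + 1)) fun m' => m' = run l m := by
  obtain ⟨c, h1, h2⟩ := det_block_aux (O := O) (F := F) (t := t) hb l
  refine ⟨_, c, h1, ?_, rfl⟩
  -- With at most six instructions the factor is `2 ^ 7 * 2 = 256`.
  have : 2 ^ (l.length + 1) ≤ 2 ^ 7 := Nat.pow_le_pow_right two_pos (by omega)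
  have := Nat.mul_le_mul_right (2 * (B + 1)) this
  omega

/-- Execution of straight-line code followed by something else. -/
theorem Det.block_andThen {B C : ℕ} (hb : Bdd m B) {l : List Ins} (hl : l.length ≤ 6)
    {f : State → PMF (Option State)} {R : Mem → Prop}
    (h : ∀ t, Det (f (run l m, t)) t C R) :
    Det (Hope.andThen (eval O F (block l) (m, t)) f) t (256 * (B + 1) + C) R :=
  (det_block hb hl).andThen fun _ t h' => h' ▸ h t

end Det

/-! ### Greatest common divisors -/

/-- Euclid's algorithm for the registers `10` and `11`. -/
def gcdBody : Prog := block [⟨9, .mod, 10, 11⟩, ⟨10, .add, 11, 16⟩, ⟨11, .add, 9, 16⟩]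

/-- Progress is measured by the product of the two registers: `2 * (a % b) < a` when `0 < b ≤ a`, so
each pass more than halves it, and `k` passes suffice if it starts below `2 ^ k`. -/
theorem det_gcd {O : ℤ → PMF ℤ} {F B k N : ℕ} (hN : k < N) {m : Mem} {t a b : ℕ}
    (h10 : m 10 = a) (h11 : m 11 = b) (h16 : m 16 = 0) (hba : b ≤ a) (hk : a * b < 2 ^ k)
    (hb : Bdd m B) :
    Det (whileN 11 (eval O F gcdBody) N (m, t)) t ((k + 1) * (300 * (B + 1))) fun m' =>
      m' 10 = (a.gcd b : ℕ) ∧ Bdd m' B ∧ ∀ i, i ≠ 9 → i ≠ 10 → i ≠ 11 → m' i = m i := by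
  induction k generalizing N m t a b with
  | zero =>
    have : b = 0 := by
      rcases Nat.eq_zero_or_pos b with h | h
      · exact h
      · have := Nat.mul_pos (h.trans_le hba) h
        omega
    subst this
    exact Det.while_stop hb (by omega) (by omega) (by simp [h11]) ⟨by simp [h10], hb, fun _ _ _ _ => rfl⟩
  | succ k ih =>
    rcases Nat.eq_zero_or_pos b with rfl | hpos
    · refine Det.while_stop hb (by omega) ?_ (by simp [h11])
        ⟨by simp [h10], hb, fun _ _ _ _ => rfl⟩
      nlinarith
    obtain ⟨N, rfl⟩ : ∃ j, N = j + 1 := ⟨N - 1, by omega⟩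
    have hr : run [⟨9, .mod, 10, 11⟩, ⟨10, .add, 11, 16⟩, ⟨11, .add, 9, 16⟩] m =
        Function.update (Function.update (Function.update m 9 ((a % b : ℕ) : ℤ)) 10 b) 11
          ((a % b : ℕ) : ℤ) := by
      simp [run, Op.eval, h10, h11, h16]
    have hlt := Nat.mod_lt a hpos
    have hB : bits ((a % b : ℕ) : ℤ) ≤ B :=
      (bits_le_bits (by positivity) (by rw [h11]; exact_mod_cast hlt.le)).trans (hb 11)
    have hb' : Bdd (run [⟨9, .mod, 10, 11⟩, ⟨10, .add, 11, 16⟩, ⟨11, .add, 9, 16⟩] m) B := by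
      rw [hr]
      exact ((hb.update _ hB).update _ (h11 ▸ hb 11)).update _ hB
    refine (Det.while_step hb (by rw [h11]; exact_mod_cast hpos) (fun t => det_block hb (by simp))
      fun m' t hm' => ?_).mono (C := 1 + B + 256 * (B + 1) + (k + 1) * (300 * (B + 1))) ?_
        fun _ h => h
    · subst hm'
      refine (ih (a := b) (b := a % b) (by omega) ?_ ?_ ?_ hlt.le ?_ hb').mono le_rfl ?_
      · simp [hr]
      · simp [hr]
      · simp [hr, h16]
      · have h1 := Nat.div_add_mod a b
        have h2 : 1 ≤ a / b := Nat.div_pos hba hpos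
        have h3 : b * 1 ≤ b * (a / b) := Nat.mul_le_mul_left b h2
        have h4 : 2 * (a % b) < a := by omega
        have h5 := Nat.mul_lt_mul_of_pos_right h4 hpos
        rw [pow_succ] at hk
        nlinarith
      · rintro m' ⟨h1, h2, h3⟩
        refine ⟨?_, h2, fun i h9 h10 h11 => ?_⟩
        · rw [h1, Nat.gcd_comm a b, Nat.gcd_rec b a, Nat.gcd_comm]
        · rw [h3 i h9 h10 h11, hr]
          simp [h9, h10, h11]
    · ring_nf
      omega

/-! ### Modular powers -/

/-- One step of square and multiply: accumulator in `12`, base in `13`, exponent in `14`, modulus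
in `4`. -/
def powBody : Prog :=
  .seq (block [⟨9, .mod, 14, 18⟩])
    (.seq (.ite 9 (block [⟨12, .mul, 12, 13⟩, ⟨12, .mod, 12, 4⟩]) .skip)
      (block [⟨13, .mul, 13, 13⟩, ⟨13, .mod, 13, 4⟩, ⟨14, .div, 14, 18⟩]))

/-- The invariant is the accumulator times the base to the exponent, modulo `M`. The accumulator is
only required to be at most `M`, not smaller, because it starts at `1` and `M = 1` is not excluded.
-/
theorem det_pow {O : ℤ → PMF ℤ} {F B k N : ℕ} (hN : k < N) {m : Mem} {t e : ℕ} {a g M : ℤ}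
    (h4 : m 4 = M) (h12 : m 12 = a) (h13 : m 13 = g) (h14 : m 14 = e) (h18 : m 18 = 2)
    (hM : 0 < M) (ha : 0 ≤ a ∧ a ≤ M) (hk : e < 2 ^ k) (hb : Bdd m B) :
    Det (whileN 14 (eval O F powBody) N (m, t)) t ((k + 1) * (1000 * (B + 1))) fun m' =>
      m' 12 ≡ a * g ^ e [ZMOD M] ∧ (0 ≤ m' 12 ∧ m' 12 ≤ M) ∧ Bdd m' B ∧
        ∀ i, i ≠ 9 → i ≠ 12 → i ≠ 13 → i ≠ 14 → m' i = m i := by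
  induction k generalizing N m t e a g with
  | zero =>
    have : e = 0 := by omega
    subst this
    refine Det.while_stop hb (by omega) (by omega) (by simp [h14])
      ⟨by simp [h12], h12 ▸ ha, hb, fun _ _ _ _ _ => rfl⟩
  | succ k ih =>
    rcases Nat.eq_zero_or_pos e with rfl | hpos
    · refine Det.while_stop hb (by omega) ?_ (by simp [h14])
        ⟨by simp [h12], h12 ▸ ha, hb, fun _ _ _ _ _ => rfl⟩
      nlinarith
    obtain ⟨N, rfl⟩ : ∃ j, N = j + 1 := ⟨N - 1, by omega⟩
    have hmod : ∀ z : ℤ, 0 ≤ z % M ∧ z % M ≤ M := fun z =>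
      ⟨Int.emod_nonneg _ hM.ne', (Int.emod_lt_of_pos _ hM).le⟩
    have hbM : ∀ z : ℤ, 0 ≤ z ∧ z ≤ M → bits z ≤ B := fun z hz =>
      (bits_le_bits hz.1 hz.2).trans (h4 ▸ hb 4)
    have hB2 : 2 ≤ bits (2 : ℤ) := by decide
    have hB : 2 ≤ B := hB2.trans (h18 ▸ hb 18)
    have hbody : ∀ t, Det (eval O F powBody (m, t)) t
        (256 * (B + 1) + (1 + B + 256 * (B + 1) + 256 * (B + 1))) fun m' =>
        (m' 12 ≡ a * g ^ (e % 2) [ZMOD M] ∧ (0 ≤ m' 12 ∧ m' 12 ≤ M)) ∧ m' 13 = g * g % M ∧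
          m' 14 = (e / 2 : ℕ) ∧ Bdd m' B ∧
          ∀ i, i ≠ 9 → i ≠ 12 → i ≠ 13 → i ≠ 14 → m' i = m i := by
      intro t
      refine Det.block_andThen hb (by simp) fun t => ?_
      have hr : run [⟨9, .mod, 14, 18⟩] m = Function.update m 9 ((e % 2 : ℕ) : ℤ) := by
        simp [run, Op.eval, h14, h18]
      have hr9 : bits ((e % 2 : ℕ) : ℤ) ≤ B := by
        refine le_trans ?_ hB
        rw [bits_le_iff]
        simp
        omega
      rw [hr]
      have hb1 := hb.update 9 hr9
      set m₁ := Function.update m 9 ((e % 2 : ℕ) : ℤ) with hm₁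
      have f1 : ∀ i, i ≠ 9 → m₁ i = m i := fun i hi => by simp [hm₁, hi]
      refine Det.andThen (Q := fun m' => (m' 12 ≡ a * g ^ (e % 2) [ZMOD M] ∧
        (0 ≤ m' 12 ∧ m' 12 ≤ M)) ∧ Bdd m' B ∧ ∀ i, i ≠ 9 → i ≠ 12 → m' i = m i) ?_ ?_
      · refine Det.ite hb1 (fun h t => ?_) (fun h t => ?_)
        · refine (det_block hb1 (by simp)).mono le_rfl ?_
          rintro _ rfl
          have he : e % 2 = 1 := by
            simp [hm₁] at h
            omega
          have hr : run [⟨12, .mul, 12, 13⟩, ⟨12, .mod, 12, 4⟩] m₁ =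
              Function.update m₁ 12 (a * g % M) := by
            simp [run, Op.eval, f1, h12, h13, h4]
          rw [hr]
          refine ⟨⟨?_, ?_⟩, hb1.update _ (hbM _ (hmod _)), fun i h9 h12 => ?_⟩
          · simp [he, Int.ModEq]
          · simpa using hmod (a * g)
          · rw [Function.update_of_ne h12, f1 i h9]
        · refine Det.skip (by omega) ?_
          have he : e % 2 = 0 := by
            simp [hm₁] at h
            omega
          refine ⟨⟨?_, ?_⟩, hb1, fun i h9 _ => f1 i h9⟩
          · simp [he, f1, h12]
          · rw [f1 12 (by decide), h12]
            exact ha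
      · rintro m₂ t ⟨h1, h2, h3⟩
        refine (det_block h2 (by simp)).mono le_rfl ?_
        rintro _ rfl
        have hr : run [⟨13, .mul, 13, 13⟩, ⟨13, .mod, 13, 4⟩, ⟨14, .div, 14, 18⟩] m₂ =
            Function.update (Function.update m₂ 13 (g * g % M)) 14 ((e / 2 : ℕ) : ℤ) := by
          simp [run, Op.eval, h3, h13, h14, h4, h18]
        rw [hr]
        refine ⟨by simpa using h1, by simp, by simp, ?_, fun i h9 h12 h13 h14 => ?_⟩
        · refine (h2.update _ (hbM _ (hmod _))).update _ ?_
          refine (bits_le_bits (by positivity) ?_).trans (h14 ▸ hb 14)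
          exact_mod_cast Nat.div_le_self e 2
        · simp [h13, h14, h3 i h9 h12]
    refine (Det.while_step hb (by rw [h14]; exact_mod_cast hpos) hbody
      fun m' t hm' => ?_).mono (C := 1 + B + (256 * (B + 1) +
        (1 + B + 256 * (B + 1) + 256 * (B + 1))) + (k + 1) * (1000 * (B + 1))) ?_ fun _ h => h
    · obtain ⟨⟨p1, p2⟩, p3, p4, p5, p6⟩ := hm'
      refine (ih (a := m' 12) (g := g * g % M) (e := e / 2) (by omega) ?_ rfl p3 p4 ?_ p2 ?_
        p5).mono le_rfl ?_
      · rw [p6 4 (by decide) (by decide) (by decide) (by decide), h4]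
      · rw [p6 18 (by decide) (by decide) (by decide) (by decide), h18]
      · rw [pow_succ] at hk
        omega
      · rintro m'' ⟨q1, q2, q3, q4⟩
        refine ⟨?_, q2, q3, fun i h9 h12 h13 h14 => ?_⟩
        · refine q1.trans ((p1.mul ((Int.mod_modEq _ _).pow _)).trans ?_)
          rw [mul_assoc, ← pow_two, ← pow_mul, ← pow_add, Nat.mod_add_div]
        · rw [q4 i h9 h12 h13 h14, p6 i h9 h12 h13 h14]
    · ring_nf
      omega

/-! ### Random candidates -/

/-- `k` random bits appended to the binary expansion of `c`. -/
def randBits : ℕ → ℕ → PMF ℕ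
  | 0, c => PMF.pure c
  | k + 1, c => (PMF.uniformOfFintype Bool).bind fun b => randBits k (2 * c + if b then 1 else 0)

/-- A register that is halved until it vanishes counts its own bit length; this is how the programs
count the rounds of sampling and the bits of a candidate. -/
theorem size_half {i k : ℕ} (hi : i.size = k + 1) : (i / 2).size = k := by
  apply le_antisymm
  · rw [Nat.size_le]
    have := Nat.size_le.1 hi.le
    rw [pow_succ] at this
    omega
  · rcases Nat.eq_zero_or_pos k with rfl | hk
    · omega
    have h1 : ¬ i.size ≤ k := by omega
    rw [Nat.size_le] at h1
    by_contra h2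
    have h3 : (i / 2).size ≤ k - 1 := by omega
    rw [Nat.size_le] at h3
    have h4 : 2 ^ k = 2 ^ (k - 1) * 2 := by rw [← pow_succ]; congr 1; omega
    omega

/-- Append a random bit to register `8`, and halve register `7`. -/
def candBody : Prog :=
  .seq (block [⟨7, .div, 7, 18⟩]) (.seq (.flip 9) (block [⟨8, .add, 8, 8⟩, ⟨8, .add, 8, 9⟩]))

section Programs

variable {O : ℤ → PMF ℤ} {F : ℕ}

/-- A deterministic computation is coupled with the trivial distribution. -/
theorem Det.cpl {α : Type*} {e : PMF (Option State)} {t C : ℕ} {Q : Mem → Prop} (h : Det e t C Q)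
    (a : α) : Cpl (PMF.pure a) e fun a' s => a' = a ∧ Q s.1 ∧ s.2 ≤ t + C := by
  obtain ⟨m, c, rfl, hc, hQ⟩ := h
  exact Cpl.pure ⟨rfl, hQ, by simpa using hc⟩

/-- A deterministic computation, followed by a random one. -/
theorem Det.cpl_andThen {α : Type*} {e : PMF (Option State)} {f : State → PMF (Option State)}
    {t C C' : ℕ} {Q : Mem → Prop} {d : PMF α} {R : α → Mem → Prop} (h : Det e t C Q)
    (h' : ∀ m t, Q m → Cpl d (f (m, t)) fun a s => R a s.1 ∧ s.2 ≤ t + C') :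
    Cpl d (Hope.andThen e f) fun a s => R a s.1 ∧ s.2 ≤ t + (C + C') := by
  obtain ⟨m, c, rfl, hc, hQ⟩ := h
  rw [andThen_pure]
  refine (h' m (t + c) hQ).mono fun a s hs => ⟨hs.1, ?_⟩
  have := hs.2
  omega

/-- A random computation, followed by a deterministic one. -/
theorem Cpl.andThen_det {α β : Type*} {e : PMF (Option State)} {f : State → PMF (Option State)}
    {t C C' : ℕ} {d : PMF α} {R : α → Mem → Prop} {Q : β → Mem → Prop} (g : α → β)
    (h : Cpl d e fun a s => R a s.1 ∧ s.2 ≤ t + C)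
    (h' : ∀ a m t, R a m → Det (f (m, t)) t C' (Q (g a))) :
    Cpl (d.map g) (Hope.andThen e f) fun b s => Q b s.1 ∧ s.2 ≤ t + (C + C') := by
  rw [← PMF.bind_pure_comp]
  refine h.andThen fun a s hs => ((h' a s.1 s.2 hs.1).cpl (g a)).mono ?_
  rintro _ s' ⟨rfl, h1, h2⟩
  exact ⟨h1, by have := hs.2; omega⟩

theorem cpl_candBody {B : ℕ} {m : Mem} {t i c : ℕ} (h7 : m 7 = i) (h8 : m 8 = c) (h18 : m 18 = 2)
    (hc : bits c < B) (hb : Bdd m B) :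
    Cpl (PMF.uniformOfFintype Bool) (eval O F candBody (m, t)) fun b s =>
      (s.1 7 = (i / 2 : ℕ) ∧ s.1 8 = (2 * c + if b then 1 else 0 : ℕ) ∧ Bdd s.1 B ∧
        ∀ j, j ≠ 7 → j ≠ 8 → j ≠ 9 → s.1 j = m j) ∧ s.2 ≤ t + 513 * (B + 1) := by
  have hr : run [⟨7, .div, 7, 18⟩] m = Function.update m 7 ((i / 2 : ℕ) : ℤ) := by
    simp [run, Op.eval, h7, h18]
  have hi : bits ((i / 2 : ℕ) : ℤ) ≤ B :=
    (bits_le_bits (by positivity) (by exact_mod_cast Nat.div_le_self i 2)).trans (h7 ▸ hb 7)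
  have hb1 := hb.update 7 hi
  refine ((det_block hb (l := [⟨7, .div, 7, 18⟩]) (by simp)).cpl_andThen
    (C' := 257 * (B + 1)) (R := fun (b : Bool) m' => m' 7 = (i / 2 : ℕ) ∧
      m' 8 = (2 * c + if b then 1 else 0 : ℕ) ∧ Bdd m' B ∧
        ∀ j, j ≠ 7 → j ≠ 8 → j ≠ 9 → m' j = m j) fun m₁ t hm₁ => ?_).mono
    fun (b : Bool) s hs => ⟨hs.1, hs.2.trans (by omega)⟩
  rw [hr] at hm₁
  subst hm₁
  simp only [eval]
  have := (cpl_flip (O := O) (F := F) 9 (Function.update m 7 ((i / 2 : ℕ) : ℤ), t)).andThen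
    (f := PMF.pure) (g := eval O F (block [⟨8, .add, 8, 8⟩, ⟨8, .add, 8, 9⟩]))
    (R' := fun (b : Bool) s => (s.1 7 = (i / 2 : ℕ) ∧ s.1 8 = (2 * c + if b then 1 else 0 : ℕ) ∧ Bdd s.1 B ∧
        ∀ j, j ≠ 7 → j ≠ 8 → j ≠ 9 → s.1 j = m j) ∧ s.2 ≤ t + 257 * (B + 1)) ?_
  · rwa [PMF.bind_pure] at this
  rintro b s rfl
  have hbb : bits (if b then 1 else 0) ≤ B := (bits_bool b).trans (by omega)
  have hb2 := hb1.update 9 hbb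
  refine ((det_block hb2 (by simp)).cpl b).mono ?_
  rintro b s ⟨rfl, h1, h2⟩
  refine ⟨?_, h2.trans (by simp; omega)⟩
  have hr : run [⟨8, .add, 8, 8⟩, ⟨8, .add, 8, 9⟩] (Function.update
      (Function.update m 7 ((i / 2 : ℕ) : ℤ)) 9 (if b then 1 else 0)) = Function.update
      (Function.update (Function.update m 7 ((i / 2 : ℕ) : ℤ)) 9 (if b then 1 else 0)) 8
        ((2 * c + if b then 1 else 0 : ℕ) : ℤ) := by
    cases b <;> simp [run, Op.eval, h8, two_mul]
  rw [h1, hr]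
  refine ⟨by simp, by simp, hb2.update _ (le_trans ?_ hc), fun j h7 h8 h9 => by simp [h7, h8, h9]⟩
  have := natAbs_lt_two_pow_bits (c : ℤ)
  rw [bits_le_iff, pow_succ]
  cases b <;> simp at * <;> omega

theorem cpl_cand {B k N : ℕ} (hN : k < N) {m : Mem} {t i c : ℕ} (h7 : m 7 = i) (h8 : m 8 = c)
    (h18 : m 18 = 2) (hi : i.size = k) (hc : bits c + k ≤ B) (hb : Bdd m B) :
    Cpl (randBits k c) (whileN 7 (eval O F candBody) N (m, t)) fun z s =>
      (s.1 8 = z ∧ Bdd s.1 B ∧ ∀ j, j ≠ 7 → j ≠ 8 → j ≠ 9 → s.1 j = m j) ∧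
        s.2 ≤ t + (k + 1) * (600 * (B + 1)) := by
  induction k generalizing N m t i c with
  | zero =>
    rw [Nat.size_eq_zero] at hi
    subst hi
    refine ((Det.while_stop (C := (0 + 1) * (600 * (B + 1))) hb (by omega) (by omega)
      (by simp [h7]) (R := fun m' => m' = m) rfl).cpl c).mono ?_
    rintro _ s ⟨rfl, h1, h2⟩
    rw [h1]
    exact ⟨⟨h8, hb, fun _ _ _ _ => rfl⟩, h2⟩
  | succ k ih =>
    obtain ⟨N, rfl⟩ : ∃ j, N = j + 1 := ⟨N - 1, by omega⟩
    have hpos : 0 < i := by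
      rw [← Nat.size_pos]
      omega
    have hi2 := size_half hi
    have hB7 := hb 7
    rw [whileN, if_pos (show 0 < m 7 by rw [h7]; exact_mod_cast hpos), randBits]
    refine (cpl_candBody (t := t + 1 + bits (m 7)) h7 h8 h18 (by omega) hb).andThen ?_
    rintro b s ⟨⟨p7, p8, p1, p2⟩, p3⟩
    have hcs : bits ((2 * c + if b then 1 else 0 : ℕ) : ℤ) ≤ bits c + 1 := by
      have := natAbs_lt_two_pow_bits (c : ℤ)
      rw [bits_le_iff, pow_succ]
      cases b <;> simp at * <;> omega
    refine (ih (N := N) (m := s.1) (t := s.2) (by omega) p7 p8 ?_ hi2 (by omega) p1).mono ?_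
    · rw [p2 18 (by decide) (by decide) (by decide), h18]
    · rintro z s' ⟨⟨q1, q2, q3⟩, q4⟩
      refine ⟨⟨q1, q2, fun j h7 h8 h9 => by rw [q3 j h7 h8 h9, p2 j h7 h8 h9]⟩, ?_⟩
      ring_nf at q4 p3 ⊢
      omega

end Programs

/-! ### Rejection sampling of units -/

/-- The candidate `c` if it represents a unit modulo `n`, otherwise the default `r`. -/
def accept (n c r : ℕ) : ℕ := if c < n ∧ n.gcd c = 1 then c else r

/-- `k` rounds of sampling a unit modulo `n`, with default value `r`. -/
def sampleUnit (n : ℕ) : ℕ → ℕ → PMF ℕ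
  | 0, r => PMF.pure r
  | k + 1, r => ((randBits n.size 0).map fun c => accept n c r).bind (sampleUnit n k)

/-- Move the candidate in register `8` to register `5` if it is a unit. -/
def checkProg : Prog :=
  .seq (block [⟨9, .sub, 1, 8⟩])
    (.ite 9
      (.seq (block [⟨10, .add, 1, 16⟩, ⟨11, .add, 8, 16⟩])
        (.seq (.loop 11 gcdBody)
          (.seq (block [⟨9, .sub, 18, 10⟩]) (.ite 9 (block [⟨5, .add, 8, 16⟩]) .skip))))
      .skip)

/-- One round of rejection sampling. -/
def roundProg : Prog :=
  .seq (block [⟨6, .div, 6, 18⟩, ⟨7, .add, 1, 16⟩, ⟨8, .add, 16, 16⟩])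
    (.seq (.loop 7 candBody) checkProg)

/-- Encrypt the content of register `y + 20` into register `x + 20`. -/
def encProg (x y : ℕ) : Prog :=
  .seq (.const 16 0) (.seq (.const 17 1) (.seq (.const 18 2)
    (.seq (block [⟨4, .mul, 1, 1⟩, ⟨5, .add, 16, 16⟩, ⟨6, .add, 0, 16⟩])
      (.seq (.loop 6 roundProg)
        (.seq (block [⟨12, .add, 17, 16⟩, ⟨13, .add, 5, 16⟩, ⟨14, .add, 1, 16⟩])
          (.seq (.loop 14 powBody)
            (block [⟨9, .mod, y + 20, 1⟩, ⟨9, .mul, 9, 1⟩, ⟨9, .add, 9, 17⟩, ⟨12, .mul, 12, 9⟩,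
              ⟨12, .mod, 12, 4⟩, ⟨x + 20, .add, 12, 16⟩])))))))

/-- The distribution of the answers of `encProg`. -/
def oracleSim (n k : ℕ) (y : ℤ) : PMF ℤ :=
  (sampleUnit n k 0).map fun r : ℕ => ((r : ℤ) ^ n * (y % n * n + 1)) % (n * n : ℤ)

section Programs

variable {O : ℤ → PMF ℤ} {F B : ℕ} {m : Mem} {t n : ℕ}

theorem eval_seq {P Q : Prog} {s : State} :
    eval O F (.seq P Q) s = andThen (eval O F P s) (eval O F Q) := rfl

theorem bits_natCast (n : ℕ) : bits (n : ℤ) = n.size := rfl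

theorem det_const {x : ℕ} {a : ℤ} :
    Det (eval O F (.const x a) (m, t)) t (1 + bits a) fun m' => m' = Function.update m x a :=
  ⟨_, _, rfl, le_rfl, rfl⟩

theorem bits_sub_le_of_nonneg {a b : ℤ} {B : ℕ} (ha : 0 ≤ a) (hb : 0 ≤ b) (h1 : bits a ≤ B)
    (h2 : bits b ≤ B) : bits (a - b) ≤ B := by
  rcases le_total a b with h | h
  · exact (bits_mono (by omega)).trans h2
  · exact (bits_mono (by omega)).trans h1

/-- Conditions are tested by signs: `n - c` is positive when `c < n`, and `2 - gcd` is positive when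
the gcd, itself positive, is `1`. The loop bound `2 * B < F` suffices for Euclid's algorithm since
`n * c < 2 ^ (2 * B)`. -/
theorem det_check {c r : ℕ} (hF : 2 * B < F) (h1 : m 1 = n) (h5 : m 5 = r) (h8 : m 8 = c)
    (h16 : m 16 = 0) (h18 : m 18 = 2) (hn : 0 < n) (hb : Bdd m B) :
    Det (eval O F checkProg (m, t)) t (2000 * (B + 1) ^ 2) fun m' =>
      m' 5 = accept n c r ∧ Bdd m' B ∧
        ∀ i, i ≠ 5 → i ≠ 9 → i ≠ 10 → i ≠ 11 → m' i = m i := by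
  have hnB : bits (n : ℤ) ≤ B := h1 ▸ hb 1
  have hcB : bits (c : ℤ) ≤ B := h8 ▸ hb 8
  have h2B : bits (2 : ℤ) ≤ B := h18 ▸ hb 18
  refine (Det.block_andThen (C := 1 + B + (256 * (B + 1) + ((2 * B + 1) * (300 * (B + 1)) +
    (256 * (B + 1) + (1 + B + 256 * (B + 1)))))) hb (by simp) fun t => ?_).mono
      (by nlinarith) fun _ h => h
  have hr : run [⟨9, .sub, 1, 8⟩] m = Function.update m 9 ((n : ℤ) - c) := by
    simp [run, Op.eval, h1, h8]
  rw [hr]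
  have hb1 : Bdd (Function.update m 9 ((n : ℤ) - c)) B := hb.update _
    (bits_sub_le_of_nonneg (by positivity) (by positivity) hnB hcB)
  refine Det.ite hb1 (fun h t => ?_) (fun h t => Det.skip (by omega) ?_)
  · have hcn : c < n := by
      simp at h
      exact h
    refine Det.block_andThen hb1 (by simp) fun t => ?_
    have hr : run [⟨10, .add, 1, 16⟩, ⟨11, .add, 8, 16⟩] (Function.update m 9 ((n : ℤ) - c)) =
        Function.update (Function.update (Function.update m 9 ((n : ℤ) - c)) 10 n) 11 c := by
      simp [run, Op.eval, h1, h8, h16]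
    rw [hr]
    have hb2 := (hb1.update 10 hnB).update 11 hcB
    set m₂ := Function.update (Function.update (Function.update m 9 ((n : ℤ) - c)) 10 n) 11 c
      with hm₂
    have hlt : n * c < 2 ^ (2 * B) := by
      have h1 := bits_le_iff.1 hnB
      have h2 := bits_le_iff.1 hcB
      rw [two_mul, pow_add]
      exact Nat.mul_lt_mul'' h1 h2
    refine (det_gcd (k := 2 * B) hF (by simp [hm₂]) (by simp [hm₂]) (by simp [hm₂, h16]) hcn.le hlt
      hb2).andThen ?_
    rintro m₃ t ⟨q1, q2, q3⟩
    refine Det.block_andThen q2 (by simp) fun t => ?_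
    have hr : run [⟨9, .sub, 18, 10⟩] m₃ = Function.update m₃ 9 (2 - (n.gcd c : ℕ)) := by
      simp [run, Op.eval, q1, q3, hm₂, h18]
    rw [hr]
    have hb3 : Bdd (Function.update m₃ 9 (2 - (n.gcd c : ℕ))) B := q2.update _
      (bits_sub_le_of_nonneg (by norm_num) (by positivity) h2B (q1 ▸ q2 10))
    have hpos : 0 < n.gcd c := Nat.gcd_pos_of_pos_left _ hn
    refine Det.ite hb3 (fun h t => ?_) (fun h t => Det.skip (by omega) ?_)
    · have hg : n.gcd c = 1 := by
        simp at h
        omega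
      refine (det_block hb3 (by simp)).mono le_rfl ?_
      rintro _ rfl
      have hr : run [⟨5, .add, 8, 16⟩] (Function.update m₃ 9 (2 - (n.gcd c : ℕ))) =
          Function.update (Function.update m₃ 9 (2 - (n.gcd c : ℕ))) 5 c := by
        simp [run, Op.eval, q3, hm₂, h8, h16]
      rw [hr]
      refine ⟨by simp [accept, hcn, hg], hb3.update _ hcB, fun i i1 i2 i3 i4 => ?_⟩
      simp [i1, i2, q3 i i2 i3 i4, hm₂, i3, i4]
    · have hg : ¬ n.gcd c = 1 := by
        simp at h
        omega
      refine ⟨by simp [accept, hg, q3, hm₂, h5], hb3, fun i i1 i2 i3 i4 => ?_⟩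
      simp [i2, q3 i i2 i3 i4, hm₂, i3, i4]
  · have hcn : ¬ c < n := by
      simp at h
      omega
    exact ⟨by simp [accept, hcn, h5], hb1, fun i i1 i2 i3 i4 => by simp [i2]⟩

theorem cpl_round {r : ℕ} (hF : 2 * B < F) (h1 : m 1 = n) (h5 : m 5 = r)
    (h16 : m 16 = 0) (h18 : m 18 = 2) (hn : 0 < n) (hb : Bdd m B) :
    Cpl ((randBits n.size 0).map fun c => accept n c r) (eval O F roundProg (m, t)) fun r' s =>
      (s.1 5 = r' ∧ s.1 6 = m 6 / 2 ∧ Bdd s.1 B ∧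
        ∀ i, (i < 5 ∨ 11 < i) → s.1 i = m i) ∧ s.2 ≤ t + 3000 * (B + 1) ^ 2 := by
  have hnB : bits (n : ℤ) ≤ B := h1 ▸ hb 1
  have hr : run [⟨6, .div, 6, 18⟩, ⟨7, .add, 1, 16⟩, ⟨8, .add, 16, 16⟩] m =
      Function.update (Function.update (Function.update m 6 (m 6 / 2)) 7 n) 8 (0 : ℕ) := by
    simp [run, Op.eval, h1, h16, h18]
  have hb1 := ((hb.update 6 ((bits_div_le (m 6) 2).trans (hb 6))).update 7 hnB).update 8
    (a := (0 : ℕ)) (by simp [bits])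
  refine ((det_block hb (l := [⟨6, .div, 6, 18⟩, ⟨7, .add, 1, 16⟩, ⟨8, .add, 16, 16⟩])
    (by simp)).cpl_andThen (C' := (B + 1) * (600 * (B + 1)) + 2000 * (B + 1) ^ 2)
    (R := fun (r' : ℕ) m' => m' 5 = r' ∧ m' 6 = m 6 / 2 ∧ Bdd m' B ∧
        ∀ i, (i < 5 ∨ 11 < i) → m' i = m i) fun m₁ t hm₁ => ?_).mono
    fun (r' : ℕ) s hs => ⟨hs.1, hs.2.trans ?_⟩
  swap
  · have e1 : (B + 1) * (600 * (B + 1)) = 600 * (B + 1) ^ 2 := by ring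
    have e2 : B + 1 ≤ (B + 1) ^ 2 := Nat.le_self_pow two_ne_zero _
    rw [e1]
    omega
  rw [hr] at hm₁
  subst hm₁
  set m₂ := Function.update (Function.update (Function.update m 6 (m 6 / 2)) 7 n) 8 ((0 : ℕ) : ℤ)
    with hm₂
  refine Cpl.andThen_det (fun c => accept n c r)
    (R := fun (c : ℕ) m' => m' 8 = c ∧ Bdd m' B ∧ ∀ j, j ≠ 7 → j ≠ 8 → j ≠ 9 → m' j = m₂ j)
    (Q := fun (r' : ℕ) m' => m' 5 = r' ∧ m' 6 = m 6 / 2 ∧ Bdd m' B ∧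
        ∀ i, (i < 5 ∨ 11 < i) → m' i = m i)
    ((cpl_cand (m := m₂) (k := n.size) (i := n) (c := 0) (N := F) (t := t) ?_ (by simp [hm₂])
      (by simp [hm₂]) (by simp [hm₂, h18]) rfl ?_ hb1).mono fun c s hs => ⟨hs.1, hs.2.trans ?_⟩) ?_
  · rw [bits_natCast] at hnB
    omega
  · simpa [bits] using hnB
  · rw [bits_natCast] at hnB
    gcongr
  rintro c m₃ t ⟨q1, q2, q3⟩
  refine (det_check hF (r := r) (n := n) ?_ ?_ q1 ?_ ?_ hn q2).mono le_rfl ?_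
  · simp [q3, hm₂, h1]
  · simp [q3, hm₂, h5]
  · simp [q3, hm₂, h16]
  · simp [q3, hm₂, h18]
  · rintro m₄ ⟨p1, p2, p3⟩
    refine ⟨p1, ?_, p2, fun i hi => ?_⟩
    · simp [p3, q3, hm₂]
    · rw [p3 i (by omega) (by omega) (by omega) (by omega), q3 i (by omega) (by omega) (by omega),
        hm₂, Function.update_of_ne (by omega), Function.update_of_ne (by omega),
        Function.update_of_ne (by omega)]

theorem cpl_sample {k r N : ℕ} (hN : k < N) (hF : 2 * B < F) (h1 : m 1 = n) (h5 : m 5 = r)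
    (h6 : (m 6).toNat.size = k) (h16 : m 16 = 0) (h18 : m 18 = 2) (hn : 0 < n) (hb : Bdd m B) :
    Cpl (sampleUnit n k r) (whileN 6 (eval O F roundProg) N (m, t)) fun r' s =>
      (s.1 5 = r' ∧ Bdd s.1 B ∧ ∀ i, (i < 5 ∨ 11 < i) → s.1 i = m i) ∧
        s.2 ≤ t + (k + 1) * (3100 * (B + 1) ^ 2) := by
  induction k generalizing N m t r with
  | zero =>
    rw [Nat.size_eq_zero] at h6
    refine ((Det.while_stop (C := (0 + 1) * (3100 * (B + 1) ^ 2)) hb (by omega) (by nlinarith)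
      (by omega) (R := fun m' => m' = m) rfl).cpl r).mono ?_
    rintro _ s ⟨rfl, h1, h2⟩
    rw [h1]
    exact ⟨⟨h5, hb, fun _ _ => rfl⟩, h2⟩
  | succ k ih =>
    obtain ⟨N, rfl⟩ : ∃ j, N = j + 1 := ⟨N - 1, by omega⟩
    have hpos : 0 < (m 6).toNat := by
      rw [← Nat.size_pos]
      omega
    have hB6 := hb 6
    rw [whileN, if_pos (show 0 < m 6 by omega), sampleUnit]
    refine (cpl_round (t := t + 1 + bits (m 6)) hF h1 h5 h16 h18 hn hb).andThen ?_
    rintro r' s ⟨⟨p5, p6, p1, p2⟩, p3⟩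
    have h6' : (s.1 6).toNat.size = k := by
      rw [← size_half h6, p6]
      congr 1
      omega
    refine (ih (N := N) (m := s.1) (t := s.2) (by omega) ?_ p5 h6' ?_ ?_ p1).mono ?_
    · rw [p2 1 (by decide), h1]
    · rw [p2 16 (by decide), h16]
    · rw [p2 18 (by decide), h18]
    · rintro z s' ⟨⟨q1, q2, q3⟩, q4⟩
      refine ⟨⟨q1, q2, fun j hj => by rw [q3 j hj, p2 j hj]⟩, ?_⟩
      have : B + 1 ≤ (B + 1) ^ 2 := Nat.le_self_pow two_ne_zero _
      rw [add_mul (k + 1)]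
      omega

/-- The number of rounds is the bit length of register `0`, which is `κ` on the input `1^κ`. The
factor `(n+1)^y` is computed in the linear form `(y mod n) n + 1`, so only `r^n` needs a modular
power. -/
theorem cpl_encProg (x y : ℕ) (hF : 2 * B < F) (h1 : m 1 = n) (hn : 0 < n)
    (hnB : 2 * bits (n : ℤ) + 2 ≤ B) (hb : Bdd m B) :
    Cpl (oracleSim n (m 0).toNat.size (m (y + 20))) (eval O F (encProg x y) (m, t)) fun a s =>
      (s.1 (x + 20) = a ∧ Bdd s.1 B ∧
        ∀ i, (i < 4 ∨ 20 ≤ i) → i ≠ x + 20 → s.1 i = m i) ∧ s.2 ≤ t + 6000 * (B + 1) ^ 3 := by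
  have hnn : bits ((n : ℤ) * n) ≤ B := (bits_mul_le _ _).trans (by omega)
  have hkB : (m 0).toNat.size ≤ B := (Nat.size_le_size (by omega)).trans (hb 0)
  have hc2 : bits (2 : ℤ) = 2 := by decide
  have hc1 : bits (1 : ℤ) = 1 := by decide
  have hc0 : bits (0 : ℤ) = 0 := by decide
  have hM : (0 : ℤ) < n * n := by positivity
  have hbM : ∀ z : ℤ, 0 ≤ z ∧ z ≤ n * n → bits z ≤ B := fun z hz =>
    (bits_le_bits hz.1 hz.2).trans hnn
  -- The relation is made a variable, and the cost a nested sum, to give the goal the shape of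
  -- `Det.cpl_andThen`.
  suffices h : ∀ R : ℤ → Mem → Prop, (R = fun a m' => m' (x + 20) = a ∧ Bdd m' B ∧
      ∀ i, (i < 4 ∨ 20 ≤ i) → i ≠ x + 20 → m' i = m i) →
      Cpl (oracleSim n (m 0).toNat.size (m (y + 20))) (eval O F (encProg x y) (m, t))
        fun a s => R a s.1 ∧ s.2 ≤ t + (1 + bits 0 + (1 + bits 1 +
          (1 + bits 2 + (256 * (B + 1) + ((B + 1) * (3100 * (B + 1) ^ 2) +
            (256 * (B + 1) + ((B + 1) * (1000 * (B + 1)) + 256 * (B + 1)))))))) by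
    refine (h _ rfl).mono fun a s hs => ⟨hs.1, hs.2.trans ?_⟩
    have e1 : (B + 1) * (3100 * (B + 1) ^ 2) = 3100 * (B + 1) ^ 3 := by ring
    have e2 : (B + 1) * (1000 * (B + 1)) = 1000 * (B + 1) ^ 2 := by ring
    have e3 : (B + 1) ^ 2 ≤ (B + 1) ^ 3 := Nat.pow_le_pow_right (by omega) (by omega)
    have e4 : B + 1 ≤ (B + 1) ^ 3 := Nat.le_self_pow (by omega) _
    rw [e1, e2, hc0, hc1, hc2]
    omega
  intro R hR
  refine det_const.cpl_andThen ?_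
  rintro _ t rfl
  refine det_const.cpl_andThen ?_
  rintro _ t rfl
  refine det_const.cpl_andThen ?_
  rintro _ t rfl
  have hb1 := ((hb.update 16 (a := 0) (by omega)).update 17 (a := 1) (by omega)).update 18 (a := 2)
    (by omega)
  refine (det_block hb1 (by simp)).cpl_andThen ?_
  rintro m₁ t rfl
  have hr : run [⟨4, .mul, 1, 1⟩, ⟨5, .add, 16, 16⟩, ⟨6, .add, 0, 16⟩]
      (Function.update (Function.update (Function.update m 16 0) 17 1) 18 2) =
      Function.update (Function.update (Function.update (Function.update (Function.update
        (Function.update m 16 0) 17 1) 18 2) 4 (n * n)) 5 (0 : ℕ)) 6 (m 0) := by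
    simp [run, Op.eval, h1]
  rw [hr]
  have hb2 := ((hb1.update 4 hnn).update 5 (a := (0 : ℕ)) (by simp [bits])).update 6 (hb 0)
  set m₂ := Function.update (Function.update (Function.update (Function.update (Function.update
    (Function.update m 16 0) 17 1) 18 2) 4 ((n : ℤ) * n)) 5 ((0 : ℕ) : ℤ)) 6 (m 0) with hm₂
  rw [oracleSim]
  refine Cpl.andThen_det (fun r : ℕ => ((r : ℤ) ^ n * (m (y + 20) % n * n + 1)) % (n * n : ℤ))
    (t := t) (R := fun r m' => m' 5 = (r : ℕ) ∧ Bdd m' B ∧ ∀ i, (i < 5 ∨ 11 < i) → m' i = m₂ i)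
    (Q := R)
    ((cpl_sample (n := n) (r := 0) (m := m₂) (N := F) (t := t) (k := (m 0).toNat.size)
      (by omega) hF (by simp [hm₂, h1])
      (by simp [hm₂]) (by simp [hm₂]) (by simp [hm₂]) (by simp [hm₂]) hn hb2).mono
      fun r s hs => ⟨hs.1, hs.2.trans (by gcongr)⟩) ?_
  rintro r m₃ t ⟨q1, q2, q3⟩
  refine (det_block q2 (by simp)).andThen ?_
  rintro m₄ t rfl
  have hr : run [⟨12, .add, 17, 16⟩, ⟨13, .add, 5, 16⟩, ⟨14, .add, 1, 16⟩] m₃ =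
      Function.update (Function.update (Function.update m₃ 12 1) 13 r) 14 n := by
    simp [run, Op.eval, q1, q3, hm₂, h1]
  have hb3 := ((q2.update 12 (a := 1) (by omega)).update 13 (a := r) (q1 ▸ q2 5)).update 14
    (a := n) (by omega)
  rw [hr]
  set m₄ := Function.update (Function.update (Function.update m₃ 12 1) 13 (r : ℤ)) 14 (n : ℤ)
    with hm₄
  have hnlt := bits_le_iff.1 (le_refl (bits (n : ℤ)))
  refine ((det_pow (k := bits (n : ℤ)) (e := n) (a := 1) (g := r) (N := F) (by omega)
    (by simp [hm₄, q3, hm₂]) (by simp [hm₄]) (by simp [hm₄]) (by simp [hm₄])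
    (by simp [hm₄, q3, hm₂]) hM ⟨by norm_num, by omega⟩ (by simpa using hnlt) hb3).mono
      (C' := (B + 1) * (1000 * (B + 1))) (by gcongr; omega) fun _ h => h).andThen ?_
  rintro m₅ t ⟨p1, p2, p3, p4⟩
  refine (det_block p3 (by simp)).mono le_rfl ?_
  rintro _ rfl
  have g1 : m₅ 1 = n := by simp [p4, hm₄, q3, hm₂, h1]
  have g4 : m₅ 4 = (n : ℤ) * n := by simp [p4, hm₄, q3, hm₂]
  have g16 : m₅ 16 = 0 := by simp [p4, hm₄, q3, hm₂]
  have g17 : m₅ 17 = 1 := by simp [p4, hm₄, q3, hm₂]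
  have gi : ∀ i, (i < 4 ∨ 20 ≤ i) → m₅ i = m i := by
    intro i hi
    rw [p4 i (by omega) (by omega) (by omega) (by omega), hm₄, Function.update_of_ne (by omega),
      Function.update_of_ne (by omega), Function.update_of_ne (by omega), q3 i (by omega), hm₂]
    iterate 6 rw [Function.update_of_ne (by omega)]
  have hr : run [⟨9, .mod, y + 20, 1⟩, ⟨9, .mul, 9, 1⟩, ⟨9, .add, 9, 17⟩, ⟨12, .mul, 12, 9⟩,
      ⟨12, .mod, 12, 4⟩, ⟨x + 20, .add, 12, 16⟩] m₅ =
      Function.update (Function.update (Function.update m₅ 9 (m (y + 20) % n * n + 1)) 12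
        ((m₅ 12 * (m (y + 20) % n * n + 1)) % (n * n))) (x + 20)
        ((m₅ 12 * (m (y + 20) % n * n + 1)) % (n * n)) := by
    simp [run, Op.eval, g1, g4, g16, g17, gi]
  have hv : (m₅ 12 * (m (y + 20) % n * n + 1)) % (n * n : ℤ) =
      ((r : ℤ) ^ n * (m (y + 20) % n * n + 1)) % (n * n) := by
    rw [one_mul] at p1
    exact p1.mul_right _
  have hm0 := Int.emod_nonneg (m (y + 20)) (show (n : ℤ) ≠ 0 by omega)
  have hmlt := Int.emod_lt_of_pos (m (y + 20)) (show (0 : ℤ) < n by omega)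
  -- Before its reduction the product may exceed the bound `B`; only the values that remain after
  -- the block have to obey it.
  have hvB : bits ((m₅ 12 * (m (y + 20) % n * n + 1)) % (n * n : ℤ)) ≤ B :=
    hbM _ ⟨Int.emod_nonneg _ hM.ne', (Int.emod_lt_of_pos _ hM).le⟩
  rw [hr, hR]
  refine ⟨by simpa using hv, ((p3.update _ (hbM _ ⟨by positivity, by nlinarith⟩)).update _
    hvB).update _ hvB, fun i hi hix => ?_⟩
  rw [Function.update_of_ne hix, Function.update_of_ne (by omega), Function.update_of_ne (by omega),
    gi i hi]

end Programs

/-! ### The distribution of the sampled units -/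

/-- The first appended bit selects one half of the range from `c * 2 ^ k` to `(c + 1) * 2 ^ k - 1`,
and the induction recombines the halves. -/
theorem ex_randBits (k c : ℕ) (f : ℕ → ℝ≥0∞) :
    ex (randBits k c) f = ((2 : ℝ≥0∞) ^ k)⁻¹ * ∑ j ∈ Finset.range (2 ^ k), f (c * 2 ^ k + j) := by
  induction k generalizing c with
  | zero => simp [randBits, ex_pure]
  | succ k ih =>
    have h2 : 2 ^ (k + 1) = 2 ^ k + 2 ^ k := by rw [pow_succ, mul_two]
    rw [randBits, ex_bind, ex_uniformOfFintype, Fintype.sum_bool, ih, ih, h2,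
      Finset.sum_range_add, ← mul_add, ← mul_assoc, pow_succ,
      ENNReal.mul_inv (Or.inr (by simp)) (Or.inr (by simp)), mul_comm (_⁻¹ : ℝ≥0∞) (2⁻¹)]
    simp only [Fintype.card_bool, Nat.cast_ofNat]
    rw [add_comm (Finset.sum _ _)]
    congr 2
    · refine Finset.sum_congr rfl fun j _ => ?_
      congr 1
      simp
      ring
    · refine Finset.sum_congr rfl fun j _ => ?_
      congr 1
      simp
      ring

/-- The representatives of the units modulo `n`. -/
def unitReps (n : ℕ) : Finset ℕ := (Finset.range n).filter fun c => n.gcd c = 1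

theorem card_unitReps (n : ℕ) : (unitReps n).card = n.totient := rfl

/-- The expectation over the representatives of a uniform unit. -/
def exUnit (n : ℕ) (f : ℕ → ℝ≥0∞) : ℝ≥0∞ := (n.totient : ℝ≥0∞)⁻¹ * ∑ c ∈ unitReps n, f c

/-- The probability that a candidate is rejected. -/
def rejectProb (n : ℕ) : ℝ≥0∞ := ((2 : ℝ≥0∞) ^ n.size)⁻¹ * ((2 ^ n.size - n.totient : ℕ) : ℝ≥0∞)

/-- The probability that a candidate is accepted. -/
def acceptProb (n : ℕ) : ℝ≥0∞ := ((2 : ℝ≥0∞) ^ n.size)⁻¹ * (n.totient : ℝ≥0∞)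

theorem totient_le_two_pow_size (n : ℕ) : n.totient ≤ 2 ^ n.size :=
  (Nat.totient_le n).trans (Nat.lt_size_self n).le

theorem acceptProb_add_rejectProb (n : ℕ) : acceptProb n + rejectProb n = 1 := by
  rw [acceptProb, rejectProb, ← mul_add, ← Nat.cast_add,
    Nat.add_sub_cancel' (totient_le_two_pow_size n)]
  push_cast
  exact ENNReal.inv_mul_cancel (by simp) (by simp)

/-- Candidates are uniform on a range that contains all representatives of units, so an accepted one
is uniform among these, whatever `r` is. -/
theorem ex_accept {n : ℕ} (hn : 0 < n) (r : ℕ) (f : ℕ → ℝ≥0∞) :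
    ex (randBits n.size 0) (fun c => f (accept n c r)) =
      acceptProb n * exUnit n f + rejectProb n * f r := by
  have hsub : unitReps n ⊆ Finset.range (2 ^ n.size) := by
    intro c hc
    simp only [unitReps, Finset.mem_filter, Finset.mem_range] at hc ⊢
    exact hc.1.trans (Nat.lt_size_self n)
  have hmem : ∀ c, c ∈ unitReps n ↔ c < n ∧ n.gcd c = 1 := fun c => by
    simp [unitReps]
  have h0 : (n.totient : ℝ≥0∞) ≠ 0 := by
    simpa using hn.ne'
  rw [ex_randBits, ← Finset.sum_sdiff hsub]
  have h1 : ∑ c ∈ unitReps n, f (accept n (0 * 2 ^ n.size + c) r) =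
      n.totient * exUnit n f := by
    rw [exUnit, ← mul_assoc, ENNReal.mul_inv_cancel h0 (by simp), one_mul]
    refine Finset.sum_congr rfl fun c hc => ?_
    rw [zero_mul, zero_add, accept, if_pos ((hmem c).1 hc)]
  have h2 : ∑ c ∈ Finset.range (2 ^ n.size) \ unitReps n, f (accept n (0 * 2 ^ n.size + c) r) =
      ((2 ^ n.size - n.totient : ℕ) : ℝ≥0∞) * f r := by
    rw [← card_unitReps, ← Finset.card_range (2 ^ n.size), ← Finset.card_sdiff_of_subset hsub,
      ← nsmul_eq_mul, ← Finset.sum_const, Finset.card_range]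
    refine Finset.sum_congr rfl fun c hc => ?_
    rw [zero_mul, zero_add, accept, if_neg]
    rw [← hmem]
    exact (Finset.mem_sdiff.1 hc).2
  rw [h1, h2, mul_add, ← mul_assoc, ← mul_assoc, add_comm]
  rfl

theorem exUnit_const {n : ℕ} (hn : 0 < n) (c : ℝ≥0∞) : exUnit n (fun _ => c) = c := by
  have h0 : (n.totient : ℝ≥0∞) ≠ 0 := by
    simpa using hn.ne'
  rw [exUnit, Finset.sum_const, card_unitReps, nsmul_eq_mul, ← mul_assoc,
    ENNReal.inv_mul_cancel h0 (by simp), one_mul]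

theorem exUnit_le_one {n : ℕ} (hn : 0 < n) {f : ℕ → ℝ≥0∞} (hf : ∀ c, f c ≤ 1) :
    exUnit n f ≤ 1 := by
  rw [← exUnit_const hn 1]
  unfold exUnit
  gcongr
  exact hf _

theorem exUnit_add_mul {n : ℕ} (f : ℕ → ℝ≥0∞) (a b : ℝ≥0∞) (hn : 0 < n) :
    exUnit n (fun c => a + b * f c) = a + b * exUnit n f := by
  conv_rhs => rw [← exUnit_const hn a]
  simp only [exUnit, Finset.sum_add_distrib, ← Finset.mul_sum]
  ring

/-- A later round may overwrite an earlier success, but only by a fresh uniform unit. The result is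
therefore a mixture of a uniform unit and the default `r`, which survives only if all rounds reject;
the weights depend neither on `r` nor on `f`. -/
theorem exists_ex_sampleUnit {n : ℕ} (hn : 0 < n) (k : ℕ) :
    ∃ a : ℝ≥0∞, a + rejectProb n ^ k = 1 ∧ ∀ r f,
      ex (sampleUnit n k r) f = a * exUnit n f + rejectProb n ^ k * f r := by
  induction k with
  | zero => exact ⟨0, by simp, fun r f => by simp [sampleUnit, ex_pure]⟩
  | succ k ih =>
    obtain ⟨a, ha, h⟩ := ih
    refine ⟨a + rejectProb n ^ k * acceptProb n, ?_, fun r f => ?_⟩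
    · rw [pow_succ, add_assoc, ← mul_add, acceptProb_add_rejectProb, mul_one, ha]
    · rw [sampleUnit, ex_bind, ex_map]
      simp only [h]
      rw [ex_accept hn r (fun c => a * exUnit n f + rejectProb n ^ k * f c), exUnit_add_mul _ _ _ hn]
      calc acceptProb n * (a * exUnit n f + rejectProb n ^ k * exUnit n f) +
            rejectProb n * (a * exUnit n f + rejectProb n ^ k * f r)
          = (acceptProb n + rejectProb n) * (a * exUnit n f) +
            rejectProb n ^ k * acceptProb n * exUnit n f +
            rejectProb n ^ k * rejectProb n * f r := by ring
        _ = _ := by rw [acceptProb_add_rejectProb, pow_succ]; ring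

theorem ex_sampleUnit_le {n : ℕ} (hn : 0 < n) (k r : ℕ) {f : ℕ → ℝ≥0∞} (hf : ∀ c, f c ≤ 1) :
    ex (sampleUnit n k r) f ≤ exUnit n f + rejectProb n ^ k := by
  obtain ⟨a, ha, h⟩ := exists_ex_sampleUnit hn k
  rw [h]
  gcongr
  · exact mul_le_of_le_one_left' (by rw [← ha]; exact le_self_add)
  · exact mul_le_of_le_one_right' (hf r)

theorem exUnit_le {n : ℕ} (hn : 0 < n) (k r : ℕ) {f : ℕ → ℝ≥0∞} (hf : ∀ c, f c ≤ 1) :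
    exUnit n f ≤ ex (sampleUnit n k r) f + rejectProb n ^ k := by
  obtain ⟨a, ha, h⟩ := exists_ex_sampleUnit hn k
  calc exUnit n f = (a + rejectProb n ^ k) * exUnit n f := by rw [ha, one_mul]
    _ = a * exUnit n f + rejectProb n ^ k * exUnit n f := add_mul _ _ _
    _ ≤ a * exUnit n f + rejectProb n ^ k * 1 := by gcongr; exact exUnit_le_one hn hf
    _ ≤ _ := by rw [h, mul_one]; gcongr; exact le_self_add

/-- At least half of the residues are units, and the range of the candidates is at most twice as
long as `n`; so at least a quarter of the candidates is accepted. -/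
theorem rejectProb_le (k : Primes) : rejectProb k.n ≤ 3 / 4 := by
  have hφ : (k.n : ℕ) ≤ 2 * Nat.totient k.n := by
    obtain ⟨p, q, hp, hq, ⟨a, rfl⟩, ⟨b, rfl⟩, hne, h1, h2⟩ := k
    have ha : a ≠ 0 := by rintro rfl; exact hp.ne_one rfl
    have hb : b ≠ 0 := by rintro rfl; exact hq.ne_one rfl
    have hab : a ≠ b := by rintro rfl; exact hne rfl
    change (2 * a + 1) * (2 * b + 1) ≤ 2 * Nat.totient ((2 * a + 1) * (2 * b + 1))
    rw [Nat.totient_mul ((Nat.coprime_primes hp hq).2 hne), Nat.totient_prime hp,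
      Nat.totient_prime hq]
    simp only [Nat.add_sub_cancel]
    -- The claim amounts to `2a + 2b + 1 ≤ 4ab`. For positive `a`, `b` it fails only at `a = b = 1`,
    -- which distinctness of the primes excludes.
    rcases Nat.lt_or_gt_of_ne hab with h | h
    · nlinarith [Nat.one_le_iff_ne_zero.2 ha, Nat.one_le_iff_ne_zero.2 hb]
    · nlinarith [Nat.one_le_iff_ne_zero.2 ha, Nat.one_le_iff_ne_zero.2 hb]
  have hs : 2 ^ (k.n : ℕ).size ≤ 2 * (k.n : ℕ) := by
    have hpos : 0 < (k.n : ℕ).size := Nat.size_pos.2 k.n.pos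
    have h := Nat.lt_size.1 (Nat.sub_one_lt hpos.ne')
    have h' : 2 ^ (k.n : ℕ).size = 2 ^ ((k.n : ℕ).size - 1) * 2 := by
      rw [← pow_succ, Nat.sub_add_cancel hpos]
    omega
  have h4 : 4 * (2 ^ (k.n : ℕ).size - Nat.totient k.n) ≤ 3 * 2 ^ (k.n : ℕ).size := by omega
  rw [rejectProb, mul_comm, ← div_eq_mul_inv]
  refine ENNReal.div_le_of_le_mul ?_
  rw [mul_comm, ← mul_div_assoc, ENNReal.le_div_iff_mul_le (by simp) (by simp)]
  have : ((4 * (2 ^ (k.n : ℕ).size - Nat.totient k.n) : ℕ) : ℝ≥0∞) ≤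
      ((3 * 2 ^ (k.n : ℕ).size : ℕ) : ℝ≥0∞) := by exact_mod_cast h4
  push_cast at this ⊢
  rwa [mul_comm _ (4 : ℝ≥0∞), mul_comm _ (3 : ℝ≥0∞)]

/-! ### Paillier encryption -/

theorem add_one_pow_modEq (n m : ℕ) :
    ((n : ℤ) + 1) ^ m ≡ m * n + 1 [ZMOD (n * n : ℤ)] := by
  induction m with
  | zero => simp [Int.ModEq]
  | succ m ih =>
    rw [pow_succ]
    refine (ih.mul_right _).trans ?_
    refine (Int.modEq_iff_dvd.2 ⟨-m, ?_⟩)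
    push_cast
    ring

theorem enc_formula (n r : ℕ) (hn : 0 < n) (y : ℤ) :
    ((((n + 1) ^ (y % n).toNat * r ^ n) % n ^ 2 : ℕ) : ℤ) =
      ((r : ℤ) ^ n * (y % n * n + 1)) % (n * n : ℤ) := by
  have h0 : 0 ≤ y % n := Int.emod_nonneg _ (by omega)
  push_cast
  rw [pow_two]
  have := (add_one_pow_modEq n (y % n).toNat).mul_right ((r : ℤ) ^ n)
  rw [Int.toNat_of_nonneg h0] at this
  rw [mul_comm ((r : ℤ) ^ n)]
  exact this

theorem sum_units (n : ℕ) [NeZero n] (f : ℕ → ℝ≥0∞) :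
    ∑ r : (ZMod n)ˣ, f (r : ZMod n).val = ∑ c ∈ unitReps n, f c := by
  refine Finset.sum_bij (fun r _ => (r : ZMod n).val) ?_ ?_ ?_ fun _ _ => rfl
  · intro r _
    simp only [unitReps, Finset.mem_filter, Finset.mem_range]
    exact ⟨ZMod.val_lt _, Nat.coprime_comm.1 (ZMod.val_coe_unit_coprime r)⟩
  · intro r _ s _ h
    exact Units.ext (ZMod.val_injective n h)
  · intro c hc
    simp only [unitReps, Finset.mem_filter, Finset.mem_range] at hc
    refine ⟨ZMod.unitOfCoprime c (Nat.coprime_comm.1 hc.2), Finset.mem_univ _, ?_⟩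
    rw [ZMod.coe_unitOfCoprime, ZMod.val_cast_of_lt hc.1]

theorem oracle_eq (n : ℕ+) (y : ℤ) :
    hopeScheme.oracle n y = (PMF.uniformOfFintype (ZMod (n : ℕ))ˣ).map fun r : (ZMod (n : ℕ))ˣ =>
      (((r : ZMod (n : ℕ)).val : ℤ) ^ (n : ℕ) * (y % (n : ℕ) * (n : ℕ) + 1)) %
        ((n : ℕ) * (n : ℕ) : ℤ) := by
  -- The casts from units to residues and from naturals to integers act on distributions; by
  -- definition they are further maps in the composition.
  change PMF.map (fun c => c) (PMF.map (fun c : ℕ => (c : ℤ)) (PMF.map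
    (fun r : ZMod (n : ℕ) => (((n : ℕ) + 1) ^ (y % (n : ℕ)).toNat * r.val ^ (n : ℕ)) % (n : ℕ) ^ 2)
    (PMF.map Units.val (PMF.uniformOfFintype (ZMod (n : ℕ))ˣ)))) = _
  simp only [PMF.map_comp]
  congr 1
  funext r
  exact enc_formula n _ n.pos y

theorem ex_oracle (n : ℕ+) (y : ℤ) (f : ℤ → ℝ≥0∞) :
    ex (hopeScheme.oracle n y) f = exUnit n fun r =>
      f (((r : ℤ) ^ (n : ℕ) * (y % (n : ℕ) * (n : ℕ) + 1)) % ((n : ℕ) * (n : ℕ) : ℤ)) := by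
  rw [oracle_eq, ex_map, ex_uniformOfFintype, ZMod.card_units_eq_totient, exUnit,
    ← sum_units (n : ℕ) fun r =>
      f (((r : ℤ) ^ (n : ℕ) * (y % (n : ℕ) * (n : ℕ) + 1)) % ((n : ℕ) * (n : ℕ) : ℤ))]

theorem ex_oracle_le (n : ℕ+) (k : ℕ) (y : ℤ) {f : ℤ → ℝ≥0∞} (hf : ∀ a, f a ≤ 1) :
    ex (hopeScheme.oracle n y) f ≤ ex (oracleSim n k y) f + rejectProb n ^ k := by
  rw [ex_oracle, oracleSim, ex_map]
  exact exUnit_le n.pos k 0 fun c => hf _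

theorem ex_oracleSim_le (n : ℕ+) (k : ℕ) (y : ℤ) {f : ℤ → ℝ≥0∞} (hf : ∀ a, f a ≤ 1) :
    ex (oracleSim n k y) f ≤ ex (hopeScheme.oracle n y) f + rejectProb n ^ k := by
  rw [ex_oracle, oracleSim, ex_map]
  exact ex_sampleUnit_le n.pos k 0 fun c => hf _

/-! ### The challenge ciphertext -/

/-- The ciphertext of `y` with the residue `x` as randomness. -/
def ciphertext (n : ℕ) (y x : ℤ) : ℤ := (x * (y % n * n + 1)) % (n * n : ℤ)

/-- The image distribution is invariant under translation by every `φ g`, hence by every element of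
`H`, so it is constant. -/
theorem map_uniformOfFintype_hom {G H : Type*} [Group G] [Group H] [Fintype G] [Fintype H]
    (φ : G →* H) (hφ : Function.Surjective φ) :
    (PMF.uniformOfFintype G).map φ = PMF.uniformOfFintype H := by
  set p := (PMF.uniformOfFintype G).map φ with hp
  have h1 : ∀ g : G, p.map (fun x => φ g * x) = p := by
    intro g
    rw [hp, PMF.map_comp]
    conv_rhs => rw [← map_uniformOfFintype_equiv (Equiv.mulLeft g), PMF.map_comp]
    congr 1
    funext x
    simp
  have h2 : ∀ y, p y = p 1 := by
    classical
    intro y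
    obtain ⟨g, rfl⟩ := hφ y
    conv_lhs => rw [← h1 g]
    rw [apply_eq_ex, ex_map, apply_eq_ex p 1]
    simp
  have h3 : ∑ y, p y = 1 := by
    rw [← PMF.tsum_coe p, tsum_fintype]
  simp only [h2, Finset.sum_const, nsmul_eq_mul, Finset.card_univ] at h3
  ext y
  rw [h2, PMF.uniformOfFintype_apply]
  exact ENNReal.eq_inv_of_mul_eq_one_left (by rw [mul_comm]; exact h3)

/-- The residue `g^n` modulo `n²` depends only on `g` modulo `n`, and a uniform unit modulo `n²`
reduces to a uniform unit modulo `n`, which is the randomness of Paillier encryption. -/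
theorem map_ciphertext_uniformResidue (n : ℕ+) (y : ℤ) :
    (uniformResidue n).map (fun x : (ZMod ((n : ℕ) ^ 2))ˣ =>
      ciphertext n y ((x : ZMod ((n : ℕ) ^ 2)).val : ℤ)) =
      hopeScheme.oracle n y := by
  have hd : (n : ℕ) ∣ (n : ℕ) ^ 2 := dvd_pow_self _ two_ne_zero
  rw [oracle_eq, ← map_uniformOfFintype_hom (ZMod.unitsMap hd) (ZMod.unitsMap_surjective hd),
    uniformResidue, uniformUnit, PMF.map_comp, PMF.map_comp]
  congr 1
  funext g
  simp only [Function.comp, ciphertext]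
  refine Int.ModEq.mul_right _ ?_
  have h1 : (((g ^ (n : ℕ) : (ZMod ((n : ℕ) ^ 2))ˣ) : ZMod ((n : ℕ) ^ 2)).val : ℤ) ≡
      ((g : ZMod ((n : ℕ) ^ 2)).val : ℤ) ^ (n : ℕ) [ZMOD ((n : ℕ) ^ 2 : ℕ)] := by
    rw [← ZMod.intCast_eq_intCast_iff]
    simp
  have h2 : ((n : ℕ) : ℤ) ∣ ((g : ZMod ((n : ℕ) ^ 2)).val : ℤ) -
      ((ZMod.unitsMap hd g : ZMod (n : ℕ)).val : ℤ) := by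
    rw [← ZMod.intCast_zmod_eq_zero_iff_dvd]
    simp [ZMod.unitsMap_val]
  -- Numbers congruent modulo `n` have `n`-th powers congruent modulo `n²`.
  have h3 := dvd_sub_pow_of_dvd_sub h2 1
  rw [pow_one] at h3
  rw [← pow_two]
  push_cast at h1
  refine h1.trans (Int.ModEq.symm (Int.modEq_iff_dvd.2 ?_))
  simpa using h3

/-- The message enters only through the factor `m n + 1`, which is coprime to `n²`; multiplication
by a unit preserves the uniform distribution. -/
theorem map_ciphertext_uniformUnit (n : ℕ+) (y : ℤ) :
    (uniformUnit n).map (fun x : (ZMod ((n : ℕ) ^ 2))ˣ =>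
      ciphertext n y ((x : ZMod ((n : ℕ) ^ 2)).val : ℤ)) =
      (uniformUnit n).map fun x : (ZMod ((n : ℕ) ^ 2))ˣ => ((x : ZMod ((n : ℕ) ^ 2)).val : ℤ) := by
  have h0 : 0 ≤ y % (n : ℕ) := Int.emod_nonneg _ (by have := n.pos; omega)
  obtain ⟨m, hm⟩ := Int.eq_ofNat_of_zero_le h0
  have hc : (m * n + 1).Coprime ((n : ℕ) ^ 2) := by
    refine Nat.Coprime.pow_right 2 ?_
    simp
  set u := ZMod.unitOfCoprime _ hc with hu
  conv_rhs => rw [uniformUnit, ← map_uniformOfFintype_equiv (Equiv.mulRight u), PMF.map_comp]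
  rw [uniformUnit]
  congr 1
  funext x
  simp only [Function.comp, ciphertext, hm, Equiv.coe_mulRight, Units.val_mul, hu,
    ZMod.coe_unitOfCoprime]
  rw [ZMod.val_mul, ZMod.val_natCast, Nat.mul_mod_mod]
  rw [Int.natCast_mod]
  push_cast
  congr 1
  rw [pow_two]

/-! ### The cost bounds the loops -/

/-- Every test costs at least one. The invariant `T < s.2 + N'` says that more tests are allowed
than the remaining budget can pay for, which turns a cost bound into an explicit loop bound. -/
theorem whileN_eq_of_tame {x T : ℕ} {E E' : State → PMF (Option State)}
    (hE : ∀ s, Tame T (E s) → E' s = E s) (g : ∀ s s', some s' ∈ (E s).support → Grows s s')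
    {N N' : ℕ} {s : State} (h : Tame T (whileN x E N s)) (hN : T < s.2 + N') :
    whileN x E' N' s = whileN x E N s := by
  induction N generalizing N' s with
  | zero => exact absurd (by simp [whileN]) h.none_notMem
  | succ N ih =>
    have hs : s.2 ≤ T := h.le_of_grows fun s' hs' => grows_whileN g hs'
    obtain ⟨N', rfl⟩ : ∃ k, N' = k + 1 := ⟨N' - 1, by omega⟩
    simp only [whileN] at h ⊢
    split_ifs at h ⊢
    · rw [hE _ (h.andThen_left fun s s' => grows_whileN g)]
      refine andThen_congr fun s' hs' => ih (h.andThen_right hs') ?_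
      have := (g _ _ hs').1
      simp only [State.test] at this
      omega
    · rfl

theorem eval_eq_of_tame {O : ℤ → PMF ℤ} {F F' T : ℕ} {P : Prog} {s : State}
    (h : Tame T (eval O F P s)) (hF : T < F') : eval O F' P s = eval O F P s := by
  induction P generalizing s with
  | skip | const | arith | flip | query => rfl
  | seq P Q ihP ihQ =>
    simp only [eval] at h ⊢
    rw [ihP (h.andThen_left fun _ _ => grows_eval)]
    exact andThen_congr fun s' hs' => ihQ (h.andThen_right hs')
  | ite x P Q ihP ihQ =>
    simp only [eval] at h ⊢
    split_ifs at h ⊢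
    · exact ihP h
    · exact ihQ h
  | loop x P ih =>
    exact whileN_eq_of_tame (fun s hs => ih hs) (fun _ _ => grows_eval) h (by omega)

theorem exec_eq_of_tame {O : ℤ → PMF ℤ} {F T : ℕ} {P : Prog} {m : Mem}
    (h : Tame T (exec O P m)) (hF : T < F) : exec O P m = eval O F P (m, 0) := by
  obtain ⟨F₀, hF₀⟩ := exists_exec_eq h.none_notMem
  rw [hF₀ F₀ le_rfl] at h ⊢
  rw [eval_eq_of_tame h hF]

theorem Tame.bdd {O : ℤ → PMF ℤ} {T L : ℕ} {P : Prog} {m : Mem} (h : Tame T (exec O P m))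
    (hb : Bdd m L) {s : State} (hs : some s ∈ (exec O P m).support) : Bdd s.1 (L + T) := by
  have hT : s.2 ≤ T := by
    obtain ⟨s', h1, h2⟩ := h _ hs
    cases h1
    exact h2
  rw [exec_eq_of_tame h (Nat.lt_succ_self T)] at hs
  exact ((grows_eval hs).2 L (by simpa using hb)).mono (by omega)

/-- A time bound for a program. -/
def TimeBound (P : Prog) (p : Polynomial ℕ) : Prop :=
  ∀ (L : ℕ) (O : ℤ → PMF ℤ) (m : Mem), (∀ y, ∀ a ∈ (O y).support, bits a ≤ L) → Bdd m L →
    Tame (p.eval L) (exec O P m)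

theorem PolyTime.exists_timeBound {P : Prog} (h : PolyTime P) : ∃ p, TimeBound P p := by
  obtain ⟨p, hp⟩ := h
  refine ⟨p, fun L O m hO hm o ho => ?_⟩
  obtain ⟨m', t, rfl, ht⟩ := hp L O m hO hm o ho
  exact ⟨(m', t), rfl, ht⟩

/-! ### The game with an arbitrary oracle and challenge -/

/-- The chosen plaintext game with encryption oracle `O` and challenge ciphertexts `ch`. -/
def game (O ch : ℤ → PMF ℤ) (A₁ A₂ : Prog) (m : Mem) : PMF Bool :=
  (exec O A₁ m).bind fun o => o.elim (PMF.pure false) fun s =>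
    (PMF.uniformOfFintype Bool).bind fun b =>
      (ch (if b then s.1 1 else s.1 0)).bind fun c =>
        (exec O A₂ (Function.update s.1 0 c)).map fun o =>
          o.elim false fun s => bitOf s.1 0 == b

/-! ### The distinguisher -/

/-- Encrypt the message chosen by register `3` with register `2` as randomness. -/
def challengeProg : Prog :=
  .seq (.const 16 0) (.seq (.const 17 1)
    (.seq (.ite 3 (block [⟨9, .add, 21, 16⟩]) (block [⟨9, .add, 20, 16⟩]))
      (block [⟨9, .mod, 9, 1⟩, ⟨9, .mul, 9, 1⟩, ⟨9, .add, 9, 17⟩, ⟨4, .mul, 1, 1⟩,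
        ⟨9, .mul, 2, 9⟩, ⟨20, .mod, 9, 4⟩])))

/-- Compare register `20` with register `3`. -/
def compareProg : Prog :=
  .seq (.const 16 0) (.seq (.const 17 1)
    (.ite 20 (block [⟨0, .add, 3, 16⟩]) (block [⟨0, .sub, 17, 3⟩])))

/-- Distinguish residues from arbitrary units by means of an adversary. -/
def distinguisher (A₁ A₂ : Prog) : Prog :=
  .ite 1
    (.seq (.const 16 0) (.seq (block [⟨20, .add, 0, 16⟩, ⟨21, .add, 1, 16⟩])
      (.seq (A₁.subst encProg) (.seq (.flip 3) (.seq challengeProg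
        (.seq (A₂.subst encProg) compareProg))))))
    .skip

section Programs

variable {O : ℤ → PMF ℤ} {F B : ℕ} {m : Mem} {t n : ℕ}

/-- The product of `x` with a number of at most `n²` stays in register `9` unreduced, and `hx` makes
room for it. -/
theorem det_challenge {x : ℤ} {b : Bool} (h1 : m 1 = n) (h2 : m 2 = x)
    (h3 : m 3 = if b then 1 else 0) (hn : 0 < n) (hx : bits x + 2 * bits (n : ℤ) ≤ B) (hB : 1 ≤ B)
    (hb : Bdd m B) :
    Det (eval O F challengeProg (m, t)) t (1000 * (B + 1)) fun m' =>
      m' 20 = ciphertext n (if b then m 21 else m 20) x ∧ Bdd m' B ∧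
        ∀ i, (i < 4 ∨ 20 < i) → m' i = m i := by
  have hc1 : bits (1 : ℤ) = 1 := by decide
  have hc0 : bits (0 : ℤ) = 0 := by decide
  have hM : (0 : ℤ) < n * n := by positivity
  have hnn : bits ((n : ℤ) * n) ≤ 2 * bits (n : ℤ) := (bits_mul_le _ _).trans (by omega)
  refine (det_const.andThen (C' := 1 + bits 1 + (1 + B + 256 * (B + 1) + 256 * (B + 1)))
    ?_).mono (by rw [hc0, hc1]; omega) fun _ h => h
  rintro _ t rfl
  refine det_const.andThen ?_
  rintro _ t rfl
  have hb1 := (hb.update 16 (a := 0) (by omega)).update 17 (a := 1) (by omega)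
  set m₁ := Function.update (Function.update m 16 0) 17 1 with hm₁
  set y := if b then m 21 else m 20 with hy
  have hyB : bits y ≤ B := by
    rw [hy]
    split_ifs
    exacts [hb 21, hb 20]
  refine Det.andThen (Q := fun m' => m' = Function.update m₁ 9 y) (Det.ite hb1 ?_ ?_) ?_
  · intro h t
    refine (det_block hb1 (by simp)).mono le_rfl ?_
    rintro _ rfl
    cases b
    · simp [hm₁, h3] at h
    · simp [run, Op.eval, hm₁, hy]
  · intro h t
    refine (det_block hb1 (by simp)).mono le_rfl ?_
    rintro _ rfl
    cases b
    · simp [run, Op.eval, hm₁, hy]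
    · simp [hm₁, h3] at h
  rintro _ t rfl
  refine (det_block (hb1.update 9 hyB) (by simp)).mono le_rfl ?_
  rintro _ rfl
  have hr : run [⟨9, .mod, 9, 1⟩, ⟨9, .mul, 9, 1⟩, ⟨9, .add, 9, 17⟩, ⟨4, .mul, 1, 1⟩,
      ⟨9, .mul, 2, 9⟩, ⟨20, .mod, 9, 4⟩] (Function.update m₁ 9 y) =
      Function.update (Function.update (Function.update m₁ 4 (n * n)) 9 (x * (y % n * n + 1))) 20
        (ciphertext n y x) := by
    funext i
    simp only [run, Op.eval, hm₁, ciphertext, Function.update_apply, h1, h2]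
    by_cases i4 : i = 4 <;> by_cases i9 : i = 9 <;> by_cases i20 : i = 20 <;> simp_all
  have hm0 := Int.emod_nonneg y (show (n : ℤ) ≠ 0 by omega)
  have hmlt := Int.emod_lt_of_pos y (show (0 : ℤ) < n by omega)
  have hz : bits (y % n * n + 1) ≤ bits ((n : ℤ) * n) :=
    bits_le_bits (by positivity) (by nlinarith)
  have hcB : bits (ciphertext n y x) ≤ bits ((n : ℤ) * n) :=
    bits_le_bits (Int.emod_nonneg _ hM.ne') (Int.emod_lt_of_pos _ hM).le
  rw [hr]
  refine ⟨by simp, ((hb1.update 4 (by omega)).update 9 ?_).update 20 (by omega), fun i hi => ?_⟩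
  · exact (bits_mul_le _ _).trans (by omega)
  · rw [Function.update_of_ne (by omega), Function.update_of_ne (by omega),
      Function.update_of_ne (by omega), hm₁, Function.update_of_ne (by omega),
      Function.update_of_ne (by omega)]

/-- A positive guess is right when `b` is `1` and any other when `b` is `0`, so the output is `b` or
`1 - b`. -/
theorem det_compare {b : Bool} (h3 : m 3 = if b then 1 else 0) (hB : 1 ≤ B) (hb : Bdd m B) :
    Det (eval O F compareProg (m, t)) t (1000 * (B + 1)) fun m' =>
      bitOf m' 0 = (decide (0 < m 20) == b) := by
  have hc1 : bits (1 : ℤ) = 1 := by decide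
  have hc0 : bits (0 : ℤ) = 0 := by decide
  refine (det_const.andThen (C' := 1 + bits 1 + (1 + B + 256 * (B + 1)))
    ?_).mono (by rw [hc0, hc1]; omega) fun _ h => h
  rintro _ t rfl
  refine det_const.andThen ?_
  rintro _ t rfl
  have hb1 := (hb.update 16 (a := 0) (by omega)).update 17 (a := 1) (by omega)
  refine Det.ite hb1 (fun h t => ?_) (fun h t => ?_)
  · refine (det_block hb1 (by simp)).mono le_rfl ?_
    rintro _ rfl
    have h' : 0 < m 20 := by simpa using h
    cases b <;> simp [run, Op.eval, bitOf, h3, h']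
  · refine (det_block hb1 (by simp)).mono le_rfl ?_
    rintro _ rfl
    have h' : ¬ 0 < m 20 := by simpa using h
    cases b <;> simp [run, Op.eval, bitOf, h3, h']

/-- What the simulated adversary leaves unchanged. -/
def Below (u : ℤ) (n : ℕ) (x v : ℤ) (B : ℕ) (m : Mem) : Prop :=
  m 0 = u ∧ m 1 = n ∧ m 2 = x ∧ m 3 = v ∧ ∀ i < 20, bits (m i) ≤ B

theorem SimRel.bdd {u : ℤ} {x v : ℤ} {m m' : Mem} (h : SimRel (Below u n x v B) m m')
    (hb : Bdd m B) : Bdd m' B := by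
  intro i
  rcases Nat.lt_or_ge i 20 with hi | hi
  · exact h.1.2.2.2.2 i hi
  · obtain ⟨j, rfl⟩ := Nat.exists_eq_add_of_le' hi
    rw [h.2]
    exact hb j

/-- The adversary and its simulation. -/
theorem cpl_subst {u x v : ℤ} {A : Prog} {T L : ℕ} {m' : Mem} (hn : 0 < n)
    (hA : Tame T (exec (oracleSim n u.toNat.size) A m)) (hL : Bdd m L) (hLT : L + T ≤ B)
    (hnB : 2 * bits (n : ℤ) + 2 ≤ B) (hF : 2 * B < F) (hr : SimRel (Below u n x v B) m m') :
    Cpl (exec (oracleSim n u.toNat.size) A m) (eval O F (A.subst encProg) (m', t)) fun o r' =>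
      (∃ r, o = some r ∧ SimRel (Below u n x v B) r.1 r'.1 ∧ Bdd r.1 (L + T) ∧
        o ∈ (exec (oracleSim n u.toNat.size) A m).support) ∧
      r'.2 ≤ t + 6000 * (B + 1) ^ 3 * T := by
  have hK : 1 ≤ 6000 * (B + 1) ^ 3 := Nat.mul_pos (by norm_num) (by positivity)
  have hex := exec_eq_of_tame hA (show T < F by omega)
  have key := simulates_subst (G := Below u n x v B) (K := 6000 * (B + 1) ^ 3) (L := L) (T := T)
    (F := F) (F' := F) (b := B) (O := oracleSim n u.toNat.size) (O' := O) (S := encProg)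
    ?_ hK le_rfl hLT ?_ A (m, 0) (m', t) (hex ▸ hA) hL hr
  · rw [← hex] at key
    refine key.and_mem.mono ?_
    rintro o r' ⟨⟨r, rfl, h1, h2⟩, h3, -⟩
    refine ⟨⟨r, rfl, h1, hA.bdd hL h3, h3⟩, ?_⟩
    have hrT : r.2 ≤ T := by
      obtain ⟨s, h4, h5⟩ := hA _ h3
      cases h4
      exact h5
    have := Nat.mul_le_mul_left (6000 * (B + 1) ^ 3) hrT
    simp only [mul_zero, add_zero] at h2
    omega
  · rintro m m' h ⟨h0, h1, h2, h3, h4⟩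
    refine ⟨?_, ?_, ?_, ?_, fun i hi => (h i hi).symm ▸ h4 i hi⟩ <;> rw [h _ (by norm_num)] <;>
      assumption
  · rintro x y m t ⟨h0, h1, h2, h3, h4⟩ hb
    have hbd : Bdd m B := by
      intro i
      rcases Nat.lt_or_ge i 20 with hi | hi
      · exact h4 i hi
      · obtain ⟨j, rfl⟩ := Nat.exists_eq_add_of_le' hi
        exact hb j
    rw [← h0]
    refine (cpl_encProg x y hF h1 hn hnB hbd).mono ?_
    rintro a r ⟨⟨p1, p2, p3⟩, p4⟩
    refine ⟨⟨?_, ?_, ?_, ?_, fun i _ => p2 i⟩, fun i => ?_, p4⟩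
    · exact p3 0 (by norm_num) (by omega)
    · rw [p3 1 (by norm_num) (by omega), h1]
    · rw [p3 2 (by norm_num) (by omega), h2]
    · rw [p3 3 (by norm_num) (by omega), h3]
    · split_ifs with hix
      · rw [hix, p1]
      · exact p3 _ (by omega) (by omega)

theorem bits_oracleSim_le {k : ℕ} (hn : 0 < n) {y a : ℤ} (ha : a ∈ (oracleSim n k y).support) :
    bits a ≤ 2 * bits (n : ℤ) := by
  rw [oracleSim, PMF.support_map] at ha
  obtain ⟨r, _, rfl⟩ := ha
  have hM : (0 : ℤ) < n * n := by positivity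
  exact (bits_le_bits (Int.emod_nonneg _ hM.ne') (Int.emod_lt_of_pos _ hM).le).trans
    ((bits_mul_le _ _).trans (by omega))

theorem bits_ciphertext_le (hn : 0 < n) (y x : ℤ) :
    bits (ciphertext n y x) ≤ 2 * bits (n : ℤ) := by
  have hM : (0 : ℤ) < n * n := by positivity
  exact (bits_le_bits (Int.emod_nonneg _ hM.ne') (Int.emod_lt_of_pos _ hM).le).trans
    ((bits_mul_le _ _).trans (by omega))

/-- The memory on which the distinguisher starts the adversary. -/
def startMem (m : Mem) : Mem :=
  Function.update (Function.update (fun i => m (i + 20)) 0 (m 0)) 1 (m 1)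

/-- The memory is arbitrary apart from a positive modulus, because polynomial time is demanded on
all memories. Inputs and oracle answers for `A₁` have length at most `2 * L`; it leaves registers of
length at most `2 * L + T₁`, from which `A₂` runs for time `T₂`. The bound `B` dominates all these
lengths and both running times. -/
theorem cpl_distinguisher {A₁ A₂ : Prog} {p₁ p₂ : Polynomial ℕ} (h₁ : TimeBound A₁ p₁)
    (h₂ : TimeBound A₂ p₂) {L : ℕ} (hL : Bdd m L) (h1 : m 1 = n) (hn : 0 < n)
    (hB : B = 4 * L + p₁.eval (2 * L) + p₂.eval (2 * L + p₁.eval (2 * L)) + 2) (hF : 2 * B < F) :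
    Cpl (game (oracleSim n (m 0).toNat.size) (fun y => PMF.pure (ciphertext n y (m 2))) A₁ A₂
      (startMem m)) (eval O F (distinguisher A₁ A₂) (m, t)) fun w s =>
        bitOf s.1 0 = w ∧ s.2 ≤ t + 20000 * (B + 1) ^ 4 := by
  set T₁ := p₁.eval (2 * L) with hT₁
  set T₂ := p₂.eval (2 * L + T₁) with hT₂
  set O' := oracleSim n (m 0).toNat.size with hO'
  have hnL : bits (n : ℤ) ≤ L := h1 ▸ hL 1
  have hbm : Bdd m B := hL.mono (by omega)
  have hc0 : bits (0 : ℤ) = 0 := by decide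
  have hO'b : ∀ y, ∀ a ∈ (O' y).support, bits a ≤ 2 * L := fun y a ha =>
    (bits_oracleSim_le hn ha).trans (by omega)
  have hsL : Bdd (startMem m) (2 * L) :=
    ((Bdd.update (fun i => hL (i + 20)) 0 (hL 0)).update 1 (hL 1)).mono (by omega)
  have ht₁ : Tame T₁ (exec O' A₁ (startMem m)) := h₁ _ _ _ hO'b hsL
  have hcost : 1 + bits (m 1) + (1 + (256 * (B + 1) + (6000 * (B + 1) ^ 3 * T₁ +
      (1 + (1000 * (B + 1) + (6000 * (B + 1) ^ 3 * T₂ + 1000 * (B + 1))))))) ≤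
      20000 * (B + 1) ^ 4 := by
    have e1 : 6000 * (B + 1) ^ 3 * T₁ + 6000 * (B + 1) ^ 3 * T₂ ≤ 6000 * (B + 1) ^ 4 := by
      rw [← mul_add, pow_succ (B + 1) 3, ← mul_assoc]
      exact Nat.mul_le_mul_left _ (by omega)
    have e2 : B + 1 ≤ (B + 1) ^ 4 := Nat.le_self_pow (by omega) _
    have := hbm 1
    omega
  rw [distinguisher, eval, if_pos (show 0 < m 1 by omega)]
  simp only [eval_seq]
  refine Cpl.mono (R := fun w s => bitOf s.1 0 = w ∧ s.2 ≤ (t + (1 + bits (m 1))) +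
      (1 + (256 * (B + 1) + (6000 * (B + 1) ^ 3 * T₁ +
      (1 + (1000 * (B + 1) + (6000 * (B + 1) ^ 3 * T₂ + 1000 * (B + 1)))))))) ?_
    fun w s hs => ⟨hs.1, hs.2.trans ?_⟩
  swap
  · rw [add_assoc]
    exact Nat.add_le_add_left (by rw [add_assoc] at hcost ⊢; exact hcost) t
  rw [State.test, add_assoc]
  suffices key : ∀ R : Bool → Mem → Prop, (R = fun w m => bitOf m 0 = w) → ∀ t,
      Cpl (game O' (fun y => PMF.pure (ciphertext n y (m 2))) A₁ A₂ (startMem m))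
      (andThen (eval O F (.const 16 0) (m, t)) fun s => andThen
        (eval O F (block [⟨20, .add, 0, 16⟩, ⟨21, .add, 1, 16⟩]) s) fun s => andThen
        (eval O F (A₁.subst encProg) s) fun s => andThen (eval O F (.flip 3) s) fun s => andThen
        (eval O F challengeProg s) fun s => andThen (eval O F (A₂.subst encProg) s)
        (eval O F compareProg)) fun w s => R w s.1 ∧ s.2 ≤ t + (1 + (256 * (B + 1) +
      (6000 * (B + 1) ^ 3 * T₁ +
      (1 + (1000 * (B + 1) + (6000 * (B + 1) ^ 3 * T₂ + 1000 * (B + 1))))))) from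
    key _ rfl _
  intro R hR t
  refine (det_const.mono (C' := 1) (by rw [hc0]) fun _ h => h).cpl_andThen ?_
  rintro _ t rfl
  have hb1 : Bdd (Function.update m 16 0) B := hbm.update 16 (by omega)
  refine (det_block hb1 (by simp)).cpl_andThen ?_
  rintro _ t rfl
  have hr : run [⟨20, .add, 0, 16⟩, ⟨21, .add, 1, 16⟩] (Function.update m 16 0) =
      Function.update (Function.update (Function.update m 16 0) 20 (m 0)) 21 (m 1) := by
    simp [run, Op.eval]
  have hb2 := (hb1.update 20 (hbm 0)).update 21 (hbm 1)
  rw [hr]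
  have hsim : SimRel (Below (m 0) n (m 2) (m 3) B) (startMem m)
      (Function.update (Function.update (Function.update m 16 0) 20 (m 0)) 21 (m 1)) := by
    refine ⟨⟨by simp, by simp [h1], by simp, by simp, fun i _ => hb2 i⟩, fun i => ?_⟩
    simp only [startMem, Function.update_apply]
    split_ifs <;> first | rfl | omega
  rw [game]
  refine (cpl_subst (O := O) (t := t) hn ht₁ hsL (by omega) (by omega) hF hsim).andThen ?_
  rintro o r' ⟨⟨r, rfl, hrel, hrb, hmem⟩, hr2⟩
  simp only [Option.elim_some]
  refine (cpl_flip 3 r').andThen ?_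
  rintro b s rfl
  rw [PMF.pure_bind]
  have hr'b := hrel.bdd (hrb.mono (by omega))
  have hb3 : Bdd (Function.update r'.1 3 (if b then 1 else 0)) B :=
    hr'b.update 3 ((bits_bool b).trans (by omega))
  have hx := hL 2
  refine Cpl.mono (R := fun w s => R w s.1 ∧ s.2 ≤ (r'.2 + 1) + (1000 * (B + 1) +
    (6000 * (B + 1) ^ 3 * T₂ + 1000 * (B + 1)))) ?_ fun w s hs => ⟨hs.1, hs.2.trans ?_⟩
  swap
  · generalize 6000 * (B + 1) ^ 3 * T₁ = X at hr2 ⊢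
    generalize 6000 * (B + 1) ^ 3 * T₂ = Y
    clear hcost
    omega
  refine (det_challenge (x := m 2) (b := b) (n := n) ?_ ?_ ?_ hn (by omega) (by omega)
    hb3).cpl_andThen ?_
  · rw [Function.update_of_ne (by norm_num)]
    exact hrel.1.2.1
  · rw [Function.update_of_ne (by norm_num)]
    exact hrel.1.2.2.1
  · simp
  rintro m₄ t ⟨q1, q2, q3⟩
  have hch : ciphertext n (if b then r.1 1 else r.1 0) (m 2) = m₄ 20 := by
    rw [q1, Function.update_of_ne (by norm_num), Function.update_of_ne (by norm_num),
      hrel.2 0, hrel.2 1]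
  set r₂ := Function.update r.1 0 (ciphertext n (if b then r.1 1 else r.1 0) (m 2)) with hr₂
  have hr₂b : Bdd r₂ (2 * L + T₁) := hrb.update 0 ((bits_ciphertext_le hn _ _).trans (by omega))
  have ht₂ : Tame T₂ (exec O' A₂ r₂) :=
    h₂ _ _ _ (fun y a ha => (hO'b y a ha).trans (by omega)) hr₂b
  have hsim₂ : SimRel (Below (m 0) n (m 2) (if b then 1 else 0) B) r₂ m₄ := by
    refine ⟨⟨?_, ?_, ?_, ?_, fun i _ => q2 i⟩, fun i => ?_⟩
    · rw [q3 0 (by norm_num), Function.update_of_ne (by norm_num)]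
      exact hrel.1.1
    · rw [q3 1 (by norm_num), Function.update_of_ne (by norm_num)]
      exact hrel.1.2.1
    · rw [q3 2 (by norm_num), Function.update_of_ne (by norm_num)]
      exact hrel.1.2.2.1
    · rw [q3 3 (by norm_num), Function.update_self]
    · rcases Nat.eq_zero_or_pos i with rfl | hi
      · rw [hr₂, Function.update_self, hch]
      · rw [q3 _ (by omega), Function.update_of_ne (by omega), hrel.2, hr₂,
          Function.update_of_ne (by omega)]
  refine Cpl.andThen_det _ (t := t) (Q := R)
    (R := fun o m' => ∃ r, o = some r ∧ SimRel (Below (m 0) n (m 2) (if b then 1 else 0) B) r.1 m' ∧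
      Bdd r.1 B)
    ((cpl_subst (O := O) (t := t) hn ht₂ hr₂b (by omega) (by omega) hF hsim₂).mono
      fun o s hs => ⟨?_, hs.2⟩) ?_
  · obtain ⟨⟨r, rfl, g1, g2, -⟩, -⟩ := hs
    exact ⟨r, rfl, g1, g2.mono (by omega)⟩
  · rintro _ m₅ t ⟨r, rfl, g1, g2⟩
    refine (det_compare (b := b) g1.1.2.2.2.1 (by omega) (g1.bdd g2)).mono le_rfl fun m₆ hm₆ => ?_
    subst hR
    change bitOf m₆ 0 = _
    rw [hm₆, g1.2 0]
    rfl

/-- On a memory with positive modulus, the coupling bounds the cost of every outcome. On any other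
the program stops after testing register `1`. -/
theorem polyTime_distinguisher {A₁ A₂ : Prog} {p₁ p₂ : Polynomial ℕ} (h₁ : TimeBound A₁ p₁)
    (h₂ : TimeBound A₂ p₂) : PolyTime (distinguisher A₁ A₂) := by
  let b : Polynomial ℕ := 4 * .X + p₁.comp (2 * .X) + p₂.comp (2 * .X + p₁.comp (2 * .X)) + 2
  refine ⟨20000 * (b + 1) ^ 4, fun L O m _ hL o ho => ?_⟩
  have hb : b.eval L = 4 * L + p₁.eval (2 * L) + p₂.eval (2 * L + p₁.eval (2 * L)) + 2 := by
    simp [b]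
  have hp : (20000 * (b + 1) ^ 4).eval L = 20000 * (b.eval L + 1) ^ 4 := by
    simp
  rw [hp]
  by_cases hn : 0 < m 1
  · obtain ⟨n, h1⟩ := Int.eq_ofNat_of_zero_le hn.le
    have key := cpl_distinguisher (O := O) (t := 0) h₁ h₂ hL h1 (by omega) hb
      (Nat.lt_succ_self _)
    rw [exec_eq_eval key.none_notMem] at ho
    obtain ⟨_, _, s, rfl, _, hs⟩ := key.exists_of_mem ho
    exact ⟨s.1, s.2, rfl, by omega⟩
  · have he : eval O 0 (distinguisher A₁ A₂) (m, 0) =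
        PMF.pure (some (m, 0 + 1 + bits (m 1) + 1)) := by
      rw [distinguisher, eval, if_neg hn]
      rfl
    rw [exec_eq_eval (F := 0) (by rw [he]; simp), he, PMF.support_pure,
      Set.mem_singleton_iff] at ho
    refine ⟨_, _, ho, ?_⟩
    have e2 : b.eval L + 1 ≤ (b.eval L + 1) ^ 4 := Nat.le_self_pow (by omega) _
    have : bits (m 1) ≤ L := hL 1
    omega

end Programs

/-! ### Comparison of the games -/

/-- The indicator of `true`. -/
def ind (w : Bool) : ℝ≥0∞ := if w then 1 else 0

theorem ind_le_one (w : Bool) : ind w ≤ 1 := by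
  cases w <;> simp [ind]

theorem apply_true_eq_ex (d : PMF Bool) : d true = ex d ind := by
  rw [apply_eq_ex]
  rfl

theorem ex_ind_le_one (d : PMF Bool) : ex d ind ≤ 1 := ex_le_const fun w _ => ind_le_one w

theorem indCPAExp_eq (gen : ℕ → PMF Primes) (A₁ A₂ : Prog) (κ : ℕ) :
    indCPAExp (fun κ => (gen κ).map Primes.keyPair) hopeScheme A₁ A₂ κ =
      (gen κ).bind fun k => game (hopeScheme.oracle k.n) (hopeScheme.oracle k.n) A₁ A₂
        (inputs [unary κ, (k.n : ℕ)]) := by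
  rw [indCPAExp, PMF.bind_map]
  congr 1
  funext k
  simp only [Function.comp, Primes.keyPair, game]
  congr 1
  funext o
  rcases o with _ | ⟨m, t⟩
  · rfl
  · simp only [Option.elim_some]
    congr 1
    funext b
    have h : ∀ (y : ℤ) (f : ℤ → PMF Bool), (hopeScheme.oracle k.n y).bind f =
        (hopeScheme.enc k.n y).bind fun c => f c := by
      intro y f
      change PMF.bind (PMF.map (fun c => c)
        (PMF.map (fun c : ℕ => (c : ℤ)) (hopeScheme.enc k.n y))) f = _
      rw [PMF.map_comp, PMF.bind_map]
      rfl
    rw [h]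
    congr 1
    funext c
    congr 1
    funext o
    rcases o with _ | ⟨m', t'⟩ <;> rfl

/-! ### Lengths and layout of the inputs -/

theorem startMem_inputs (u n x : ℤ) : startMem (inputs [u, n, x]) = inputs [u, n] := by
  funext i
  rcases i with _ | _ | i <;> simp [startMem, inputs]

theorem bdd_inputs {u n x : ℤ} {L : ℕ} (hu : bits u ≤ L) (hn : bits n ≤ L) (hx : bits x ≤ L) :
    Bdd (inputs [u, n, x]) L := by
  intro i
  rcases i with _ | _ | _ | i <;> simp [inputs, *]
  simp [bits]

theorem size_unary (κ : ℕ) : (unary κ).toNat.size = κ := by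
  have hpos : 0 < 2 ^ κ := Nat.two_pow_pos κ
  have h : (unary κ).toNat = 2 ^ κ - 1 := by
    have : unary κ = ((2 ^ κ - 1 : ℕ) : ℤ) := by
      rw [unary, Nat.cast_sub hpos]
      simp
    rw [this, Int.toNat_natCast]
  rw [h]
  apply le_antisymm
  · rw [Nat.size_le]
    omega
  · rcases κ with _ | κ
    · simp
    · by_contra hlt
      have h1 : (2 ^ (κ + 1) - 1).size ≤ κ := by omega
      rw [Nat.size_le, pow_succ] at h1
      have := Nat.two_pow_pos κ
      omega

theorem bits_unary (κ : ℕ) : bits (unary κ) = κ := by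
  conv_rhs => rw [← size_unary κ]
  rw [bits]
  congr 1
  have : (0 : ℤ) < 2 ^ κ := by positivity
  have : 0 ≤ unary κ := by
    rw [unary]
    omega
  omega

/-- The residue is drawn before the adversary starts, whereas the game draws the challenge on
demand. The draw is independent of `A₁` and of `b` and is used once, so the order is immaterial. -/
theorem bind_game {α : Type*} (d : PMF α) (O : ℤ → PMF ℤ) (g : ℤ → α → ℤ) (A₁ A₂ : Prog)
    (m : Mem) :
    (d.bind fun x => game O (fun y => PMF.pure (g y x)) A₁ A₂ m) =
      game O (fun y => d.map (g y)) A₁ A₂ m := by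
  simp only [game]
  rw [PMF.bind_comm]
  congr 1
  funext o
  rcases o with _ | s
  · simp
  · simp only [Option.elim_some]
    rw [PMF.bind_comm]
    congr 1
    funext b
    rw [PMF.bind_map]
    simp only [PMF.pure_bind]
    rfl

theorem residueExp_eq {A₁ A₂ : Prog} {p₁ p₂ : Polynomial ℕ} (h₁ : TimeBound A₁ p₁)
    (h₂ : TimeBound A₂ p₂) (gen : ℕ → PMF Primes)
    (h : ∀ n : ℕ+, PMF (ZMod ((n : ℕ) ^ 2))ˣ) (κ : ℕ) :
    residueExp gen h (distinguisher A₁ A₂) κ = (gen κ).bind fun k =>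
      game (oracleSim k.n κ) (fun y => (h k.n).map fun x : (ZMod ((k.n : ℕ) ^ 2))ˣ =>
        ciphertext k.n y ((x : ZMod ((k.n : ℕ) ^ 2)).val : ℤ)) A₁ A₂
          (inputs [unary κ, (k.n : ℕ)]) := by
  rw [residueExp]
  congr 1
  funext k
  rw [← bind_game]
  congr 1
  funext x
  set z : ℤ := ((x : ZMod ((k.n : ℕ) ^ 2)).val : ℤ)
  set m := inputs [unary κ, ((k.n : ℕ) : ℤ), z] with hm
  have hb : Bdd m (bits (unary κ) + bits ((k.n : ℕ) : ℤ) + bits z) :=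
    bdd_inputs (by omega) (by omega) (by omega)
  have key := cpl_distinguisher (O := noOracle) (t := 0) (n := k.n) h₁ h₂ hb (by simp [hm, inputs])
    k.n.pos rfl (Nat.lt_succ_self _)
  rw [exec_eq_eval key.none_notMem]
  have h0 : m 0 = unary κ := by simp [hm, inputs]
  have h2 : m 2 = z := by simp [hm, inputs]
  rw [h0, h2, size_unary, hm, startMem_inputs, ← hm] at key
  rw [key.map_eq id _ fun a s hs => ?_]
  · exact PMF.map_id _
  · exact hs.1

/-- The hybrid bound is applied to `A₂`, on a memory of length at most `L + T₁` left by `A₁`, and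
then to `A₁` with the rest of the game as test function. -/
theorem ex_game_le {ε : ℝ≥0∞} {O O' ch : ℤ → PMF ℤ}
    (hO : ∀ y (f : ℤ → ℝ≥0∞), (∀ a, f a ≤ 1) → ex (O y) f ≤ ex (O' y) f + ε)
    {A₁ A₂ : Prog} {p₁ p₂ : Polynomial ℕ} (h₁ : TimeBound A₁ p₁) (h₂ : TimeBound A₂ p₂) {L : ℕ}
    (hb : ∀ y, ∀ a ∈ (O y).support, bits a ≤ L) (hb' : ∀ y, ∀ a ∈ (O' y).support, bits a ≤ L)
    (hch : ∀ y, ∀ a ∈ (ch y).support, bits a ≤ L) {m : Mem} (hm : Bdd m L) :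
    ex (game O ch A₁ A₂ m) ind ≤ ex (game O' ch A₁ A₂ m) ind +
      ε * (p₁.eval L + p₂.eval (L + p₁.eval L) : ℕ) := by
  have ht := h₁ L O m hb hm
  have ht' := h₁ L O' m hb' hm
  set T₁ := p₁.eval L
  set T₂ := p₂.eval (L + T₁)
  simp only [game, ex_bind]
  set Φ : (ℤ → PMF ℤ) → Option State → ℝ≥0∞ := fun O o => ex (o.elim (PMF.pure false) fun s =>
    (PMF.uniformOfFintype Bool).bind fun b =>
      (ch (if b then s.1 1 else s.1 0)).bind fun c =>
        (exec O A₂ (Function.update s.1 0 c)).map fun o =>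
          o.elim false fun s => bitOf s.1 0 == b) ind with hΦ
  have step : ∀ o ∈ (exec O A₁ m).support, Φ O o ≤ Φ O' o + ε * T₂ := by
    intro o ho
    obtain ⟨s, rfl, -⟩ := ht o ho
    simp only [hΦ, Option.elim_some, ex_bind, ex_map]
    rw [← ex_const (PMF.uniformOfFintype Bool) (ε * T₂), ← ex_add]
    refine ex_mono fun b _ => ?_
    rw [← ex_const (ch (if b then s.1 1 else s.1 0)) (ε * T₂), ← ex_add]
    refine ex_mono fun c hc => ?_
    have hbd : Bdd (Function.update s.1 0 c) (L + T₁) :=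
      (ht.bdd hm ho).update 0 ((hch _ c hc).trans (Nat.le_add_right _ _))
    refine ex_exec_le hO (h₂ _ _ _ (fun y a ha => (hb y a ha).trans (Nat.le_add_right _ _))
      hbd).none_notMem (fun o ho => ?_) fun o => ind_le_one _
    obtain ⟨s', rfl, hs'⟩ := h₂ _ _ _ (fun y a ha => (hb' y a ha).trans (Nat.le_add_right _ _))
      hbd o ho
    exact ⟨s'.1, s'.2, rfl, hs'⟩
  calc ex (exec O A₁ m) (Φ O) ≤ ex (exec O A₁ m) fun o => Φ O' o + ε * T₂ := ex_mono step
    _ = ex (exec O A₁ m) (Φ O') + ε * T₂ := by rw [ex_add, ex_const]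
    _ ≤ ex (exec O' A₁ m) (Φ O') + ε * T₁ + ε * T₂ := by
        gcongr
        refine ex_exec_le hO ht.none_notMem (fun o ho => ?_) fun o => ex_ind_le_one _
        obtain ⟨s', rfl, hs'⟩ := ht' o ho
        exact ⟨s'.1, s'.2, rfl, hs'⟩
    _ = _ := by
        push_cast
        rw [mul_add, add_assoc]

/-- If the challenge does not depend on the message, the adversary can only guess. -/
theorem ex_game_const {O : ℤ → PMF ℤ} {d : PMF ℤ} {A₁ A₂ : Prog} {p₁ p₂ : Polynomial ℕ}
    (h₁ : TimeBound A₁ p₁) (h₂ : TimeBound A₂ p₂) {L : ℕ}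
    (hb : ∀ y, ∀ a ∈ (O y).support, bits a ≤ L) (hd : ∀ a ∈ d.support, bits a ≤ L) {m : Mem}
    (hm : Bdd m L) : ex (game O (fun _ => d) A₁ A₂ m) ind = 2⁻¹ := by
  have ht := h₁ L O m hb hm
  rw [game, ex_bind, ← ex_const (exec O A₁ m) 2⁻¹]
  refine ex_congr fun o ho => ?_
  obtain ⟨s, rfl, -⟩ := ht o ho
  simp only [Option.elim_some, ex_bind, ex_map]
  rw [ex_uniformOfFintype, Fintype.sum_bool, ← ex_add]
  simp only [Fintype.card_bool, Nat.cast_ofNat]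
  rw [ex_congr (g := fun _ => 1), ex_const, mul_one]
  intro c hc
  -- For a fixed challenge the runs for the two values of `b` coincide, and the guess is right for
  -- exactly one of them.
  rw [← ex_add, ex_congr (g := fun _ => 1), ex_const]
  intro o ho'
  obtain ⟨s', rfl, -⟩ := h₂ (L + p₁.eval L) _ _
    (fun y a ha => (hb y a ha).trans (Nat.le_add_right _ _))
    ((ht.bdd hm ho).update 0 ((hd c hc).trans (Nat.le_add_right _ _))) o ho'
  simp only [Option.elim_some]
  cases bitOf s'.1 0 <;> simp [ind]

theorem bits_oracle_le (n : ℕ+) {y a : ℤ} (ha : a ∈ (hopeScheme.oracle n y).support) :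
    bits a ≤ 2 * bits ((n : ℕ) : ℤ) := by
  rw [← map_ciphertext_uniformResidue, PMF.support_map] at ha
  obtain ⟨x, _, rfl⟩ := ha
  exact bits_ciphertext_le n.pos _ _

/-! ### Negligible functions -/

theorem negligible_polynomial_mul_pow (q : Polynomial ℕ) :
    Negligible fun κ => ((q.eval κ : ℕ) : ℝ) * (3 / 4 : ℝ) ^ κ := by
  have h : Asymptotics.SuperpolynomialDecay Filter.atTop (fun κ : ℕ => (κ : ℝ))
      fun κ => (3 / 4 : ℝ) ^ κ := fun n =>
    tendsto_pow_const_mul_const_pow_of_abs_lt_one n (by rw [abs_lt]; norm_num)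
  have := h.polynomial_mul (q.map (Nat.castRingHom ℝ))
  simp only [Polynomial.eval_natCast_map, Nat.cast_id, eq_natCast] at this
  exact this

theorem Negligible.mono {f g : ℕ → ℝ} (hf : Negligible f) (h : ∀ κ, |g κ| ≤ f κ) :
    Negligible g :=
  Asymptotics.SuperpolynomialDecay.trans_eventually_abs_le hf
    (Filter.Eventually.of_forall fun κ => (h κ).trans (le_abs_self _))

/-! ### The advantage of the adversary -/

section Advantage

variable {A₁ A₂ : Prog} {p₁ p₂ : Polynomial ℕ} {gen : ℕ → PMF Primes} {κ b : ℕ}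

theorem bdd_inputs_two {u n : ℤ} {L : ℕ} (hu : bits u ≤ L) (hn : bits n ≤ L) :
    Bdd (inputs [u, n]) L := by
  intro i
  rcases i with _ | _ | i <;> simp [inputs, *]
  simp [bits]

/-- Simulating the encryption oracle changes the probability of winning only a little. -/
theorem abs_indCPAExp_sub_residueExp_le (h₁ : TimeBound A₁ p₁) (h₂ : TimeBound A₂ p₂)
    (hb : ∀ k ∈ (gen κ).support, (k.n : ℕ).size ≤ b) :
    |prTrue (indCPAExp (fun κ => (gen κ).map Primes.keyPair) hopeScheme A₁ A₂ κ) -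
      prTrue (residueExp gen uniformResidue (distinguisher A₁ A₂) κ)| ≤
      (p₁.eval (κ + 2 * b) + p₂.eval (κ + 2 * b + p₁.eval (κ + 2 * b)) : ℕ) * (3 / 4 : ℝ) ^ κ := by
  set T := p₁.eval (κ + 2 * b) + p₂.eval (κ + 2 * b + p₁.eval (κ + 2 * b)) with hT
  set x := (indCPAExp (fun κ => (gen κ).map Primes.keyPair) hopeScheme A₁ A₂ κ) true with hx
  set y := (residueExp gen uniformResidue (distinguisher A₁ A₂) κ) true with hy
  have hx' : x = ex (gen κ) fun k => ex (game (hopeScheme.oracle k.n) (hopeScheme.oracle k.n) A₁ A₂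
      (inputs [unary κ, (k.n : ℕ)])) ind := by
    rw [hx, apply_true_eq_ex, indCPAExp_eq, ex_bind]
  have hy' : y = ex (gen κ) fun k => ex (game (oracleSim k.n κ) (hopeScheme.oracle k.n) A₁ A₂
      (inputs [unary κ, (k.n : ℕ)])) ind := by
    rw [hy, apply_true_eq_ex, residueExp_eq h₁ h₂, ex_bind]
    simp only [map_ciphertext_uniformResidue]
  set ε : ℝ≥0∞ := (3 / 4) ^ κ * T with hε
  have hεk : ∀ k : Primes, rejectProb k.n ^ κ * (T : ℝ≥0∞) ≤ ε := fun k => by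
    rw [hε]
    gcongr
    exact rejectProb_le k
  -- The length `κ + 2 * b` accommodates `1^κ`, the modulus and all ciphertexts, which lie below
  -- `n²`.
  have hbits : ∀ k ∈ (gen κ).support, 2 * bits (((k.n : ℕ) : ℕ) : ℤ) ≤ κ + 2 * b := fun k hk => by
    have := hb k hk
    rw [bits_natCast]
    omega
  have hm : ∀ k ∈ (gen κ).support, Bdd (inputs [unary κ, ((k.n : ℕ) : ℤ)]) (κ + 2 * b) := by
    intro k hk
    have := hbits k hk
    exact bdd_inputs_two (by rw [bits_unary]; omega) (by omega)
  have hxy : x ≤ y + ε := by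
    rw [hx', hy', ← ex_const (gen κ) ε, ← ex_add]
    refine ex_mono fun k hk => ?_
    refine (ex_game_le (fun y f hf => ex_oracle_le k.n κ y hf) h₁ h₂
      (fun y a ha => (bits_oracle_le k.n ha).trans (hbits k hk))
      (fun y a ha => (bits_oracleSim_le k.n.pos ha).trans (hbits k hk))
      (fun y a ha => (bits_oracle_le k.n ha).trans (hbits k hk)) (hm k hk)).trans ?_
    exact add_le_add le_rfl (hεk k)
  have hyx : y ≤ x + ε := by
    rw [hx', hy', ← ex_const (gen κ) ε, ← ex_add]
    refine ex_mono fun k hk => ?_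
    refine (ex_game_le (fun y f hf => ex_oracleSim_le k.n κ y hf) h₁ h₂
      (fun y a ha => (bits_oracleSim_le k.n.pos ha).trans (hbits k hk))
      (fun y a ha => (bits_oracle_le k.n ha).trans (hbits k hk))
      (fun y a ha => (bits_oracle_le k.n ha).trans (hbits k hk)) (hm k hk)).trans ?_
    exact add_le_add le_rfl (hεk k)
  have hxt : x ≠ ⊤ := PMF.apply_ne_top _ _
  have hyt : y ≠ ⊤ := PMF.apply_ne_top _ _
  have hεt : ε ≠ ⊤ := ENNReal.mul_ne_top
    (ENNReal.pow_ne_top (ENNReal.div_ne_top (by simp) (by simp))) (by simp)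
  have hεr : ε.toReal = T * (3 / 4 : ℝ) ^ κ := by
    rw [hε, ENNReal.toReal_mul, ENNReal.toReal_pow, ENNReal.toReal_div, mul_comm]
    simp
  have e1 := ENNReal.toReal_mono (ENNReal.add_ne_top.2 ⟨hyt, hεt⟩) hxy
  have e2 := ENNReal.toReal_mono (ENNReal.add_ne_top.2 ⟨hxt, hεt⟩) hyx
  rw [ENNReal.toReal_add hyt hεt, hεr] at e1
  rw [ENNReal.toReal_add hxt hεt, hεr] at e2
  rw [prTrue, prTrue, abs_le]
  constructor <;> linarith

/-- The challenge is independent of the message whatever the oracle is, so the imperfect sampling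
causes no error here. -/
theorem prTrue_residueExp_uniformUnit (h₁ : TimeBound A₁ p₁) (h₂ : TimeBound A₂ p₂) :
    prTrue (residueExp gen uniformUnit (distinguisher A₁ A₂) κ) = 1 / 2 := by
  rw [prTrue, apply_true_eq_ex, residueExp_eq h₁ h₂, ex_bind]
  have h : ∀ k : Primes, ex (game (oracleSim k.n κ) (fun y => (uniformUnit k.n).map
      fun x : (ZMod ((k.n : ℕ) ^ 2))ˣ => ciphertext k.n y ((x : ZMod ((k.n : ℕ) ^ 2)).val : ℤ))
        A₁ A₂ (inputs [unary κ, (k.n : ℕ)])) ind = 2⁻¹ := by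
    intro k
    have hc : ∀ y, ∀ a ∈ ((uniformUnit k.n).map fun x : (ZMod ((k.n : ℕ) ^ 2))ˣ =>
        ciphertext k.n y ((x : ZMod ((k.n : ℕ) ^ 2)).val : ℤ)).support,
        bits a ≤ κ + 2 * bits ((k.n : ℕ) : ℤ) := by
      intro y a ha
      rw [PMF.support_map] at ha
      obtain ⟨x, _, rfl⟩ := ha
      exact (bits_ciphertext_le k.n.pos _ _).trans (Nat.le_add_left _ _)
    have hc0 := hc 0
    simp only [map_ciphertext_uniformUnit] at hc0 ⊢
    exact ex_game_const h₁ h₂ (L := κ + 2 * bits ((k.n : ℕ) : ℤ))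
      (fun y a ha => (bits_oracleSim_le k.n.pos ha).trans (Nat.le_add_left _ _)) hc0
      (bdd_inputs_two (by rw [bits_unary]; omega) (by omega))
  simp only [h, ex_const]
  simp

end Advantage

end Hope

end

/-- Let `gen` be a generator of Paillier primes with moduli of polynomially bounded length. If the
decisional `n`-th residue problem is intractable for these moduli, the signed extension of Paillier
with homomorphic addition and subtraction is IND-CPA secure. -/
theorem mainTheorem1 (gen : ℕ → PMF Hope.Primes)
    (hlen : ∃ B : Polynomial ℕ, ∀ κ : ℕ, ∀ k ∈ (gen κ).support, (k.n : ℕ).size ≤ B.eval κ)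
    (hres : Hope.NthResidueHard gen) :
    Hope.INDCPASecure (fun κ => (gen κ).map Hope.Primes.keyPair) Hope.hopeScheme := by
  intro A₁ A₂ hA₁ hA₂
  obtain ⟨B, hB⟩ := hlen
  obtain ⟨p₁, h₁⟩ := hA₁.exists_timeBound
  obtain ⟨p₂, h₂⟩ := hA₂.exists_timeBound
  let l : Polynomial ℕ := .X + 2 * B
  have hl := Hope.negligible_polynomial_mul_pow (p₁.comp l + p₂.comp (l + p₁.comp l))
  refine Hope.Negligible.mono ((hres _ (Hope.polyTime_distinguisher h₁ h₂)).add hl) fun κ => ?_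
  have h := Hope.abs_indCPAExp_sub_residueExp_le h₁ h₂ (hB κ)
  simp only [l, Polynomial.eval_add, Polynomial.eval_comp, Polynomial.eval_X, Polynomial.eval_mul,
    Polynomial.eval_ofNat, Pi.add_apply, Hope.prTrue_residueExp_uniformUnit h₁ h₂] at h ⊢
  rw [abs_abs]
  -- The triangle inequality passes through the experiment with a uniform residue; the one with a
  -- uniform unit has already been replaced by `1 / 2`.
  exact (abs_sub_le _ _ _).trans ((add_comm _ _).le.trans (add_le_add_right h _))
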